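/- Write points of $\mathbb{R}^{2n}$ as $(x,y)$ with $x,y\in\mathbb{R}^n$, and let $\omega=\sum_i dx_i\wedge dy_i$. For open sets $U,V\subset\mathbb{R}^{2n}$, a symplectic embedding $U\to V$ is a smooth injective map $f:U\to V$ with $f^*\omega=\omega$. For $R>0$ let $B^{2n}(R)=\{(x,y):\pi(\|x\|^2+\|y\|^2)<R\}$ and $Z^{2n}(R)=\{(x,y):\pi(x_1^2+y_1^2)<R\}$, where $\|\cdot\|$ is the Euclidean norm. A symplectic capacity is a map $c$ from the open subsets of $\mathbb{R}^{2n}$ to $[0,\infty]$ such that (1) $c(U)\le c(V)$ whenever there is a symplectic embedding $U\to V$; (2) $c(\lambda U)=\lambda^2c(U)$ for all $\lambda>0$; (3) $0<c(B^{2n}(1))\le c(Z^{2n}(1))<\infty$. It is normalized if $c(B^{2n}(1))=c(Z^{2n}(1))=1$. The Gromov width is $Gr(U)=\sup\{R>0: B^{2n}(R)\text{ embeds symplectically into }U\}$ and the cylindrical capacity is $c_Z(U)=\inf\{R>0: U\text{ embeds symplectically into }Z^{2n}(R)\}$. Let $2\le p<\infty$, let $$X_p=\{(x,y)\in\mathbb{R}^2\times\mathbb{R}^2=\mathbb{R}^4:\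 \|x\|^p+\|y\|^p<1\},\qquad a_p=\frac{4\,\Gamma(1+\frac1p)^2}{\Gamma(1+\frac2p)}.$$ Then all normalized symplectic capacities on $\mathbb{R}^4$ coincide on $X_p$, with common value $a_p$: every normalized symplectic capacity $c$ satisfies $c(X_p)=a_p$. Moreover, $a_p\le Gr(X_p)$ and $c_Z(X_p)\le a_p$. -/

import Mathlib

open scoped ENNReal Pointwise

namespace SymplecticCapacity

/-- The standard phase space `ℝ²ⁿ = ℝⁿ × ℝⁿ` with points `z = (x, y)`; both factors carry the
Euclidean norm. (The product norm that Lean puts on the pair is used only for the topology and the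
differential calculus, for which all norms on `ℝ²ⁿ` are equivalent.) -/
abbrev PhaseSpace (n : ℕ) : Type := EuclideanSpace ℝ (Fin n) × EuclideanSpace ℝ (Fin n)

/-- The standard symplectic form `ω = ∑ dxᵢ ∧ dyᵢ`. -/
def omega {n : ℕ} (u v : PhaseSpace n) : ℝ :=
  ∑ i, (u.1 i * v.2 i - u.2 i * v.1 i)

/-- `f` restricts to a smooth symplectic embedding of the open set `U` into the open set `V`.
(An injective smooth map with `f^*ω = ω` between open sets of the same dimension is a
diffeomorphism onto an open image.) -/
structure IsSymplecticEmbedding {n : ℕ} (U V : TopologicalSpace.Opens (PhaseSpace n))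
    (f : PhaseSpace n → PhaseSpace n) : Prop where
  contDiffOn : ContDiffOn ℝ ((⊤ : ℕ∞) : WithTop ℕ∞) f (U : Set (PhaseSpace n))
  mapsTo : Set.MapsTo f U V
  injOn : Set.InjOn f U
  pullback : ∀ z ∈ U, ∀ u v : PhaseSpace n, omega (fderiv ℝ f z u) (fderiv ℝ f z v) = omega u v

/-- There is a symplectic embedding `U → V`. -/
def SymplecticallyEmbeds {n : ℕ} (U V : TopologicalSpace.Opens (PhaseSpace n)) : Prop :=
  ∃ f : PhaseSpace n → PhaseSpace n, IsSymplecticEmbedding U V f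

/-- The open ball `B²ⁿ(R) = {z | π ‖z‖² < R}` of capacity `R`. -/
def ball (n : ℕ) (R : ℝ) : TopologicalSpace.Opens (PhaseSpace n) :=
  ⟨{z | Real.pi * (‖z.1‖ ^ 2 + ‖z.2‖ ^ 2) < R}, isOpen_lt (by fun_prop) continuous_const⟩

/-- The open symplectic cylinder `Z²ⁿ(R) = B²(R) × ℝ²ⁿ⁻²`, the disc lying in the symplectic plane
of the first conjugate pair of coordinates. -/
def cylinder (n : ℕ) [NeZero n] (R : ℝ) : TopologicalSpace.Opens (PhaseSpace n) :=
  ⟨{z | Real.pi * (z.1 0 ^ 2 + z.2 0 ^ 2) < R}, isOpen_lt (by fun_prop) continuous_const⟩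

/-- The rescaled open set `r U = {r z | z ∈ U}`, for `r > 0`. -/
def rescale {n : ℕ} (r : ℝ) (hr : 0 < r) (U : TopologicalSpace.Opens (PhaseSpace n)) :
    TopologicalSpace.Opens (PhaseSpace n) :=
  ⟨r • (U : Set (PhaseSpace n)), U.isOpen.smul₀ hr.ne'⟩

/-- Symplectic capacities on the open subsets of `ℝ²ⁿ`. -/
structure IsSymplecticCapacity {n : ℕ} [NeZero n]
    (c : TopologicalSpace.Opens (PhaseSpace n) → ℝ≥0∞) : Prop where
  monotone : ∀ U V, SymplecticallyEmbeds U V → c U ≤ c V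
  rescaling : ∀ (r : ℝ) (hr : 0 < r) (U : TopologicalSpace.Opens (PhaseSpace n)),
    c (rescale r hr U) = ENNReal.ofReal (r ^ 2) * c U
  ball_pos : 0 < c (ball n 1)
  ball_le_cylinder : c (ball n 1) ≤ c (cylinder n 1)
  cylinder_lt_top : c (cylinder n 1) < ⊤

/-- Normalized symplectic capacities. -/
structure IsNormalizedCapacity {n : ℕ} [NeZero n]
    (c : TopologicalSpace.Opens (PhaseSpace n) → ℝ≥0∞) : Prop extends IsSymplecticCapacity c where
  ball_eq_one : c (ball n 1) = 1
  cylinder_eq_one : c (cylinder n 1) = 1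

/-- The Gromov width `sup {R > 0 | B²ⁿ(R) embeds symplectically into U}`, with values in `[0, ∞]`. -/
noncomputable def gromovWidth {n : ℕ} (U : TopologicalSpace.Opens (PhaseSpace n)) : ℝ≥0∞ :=
  sSup {a | ∃ R : ℝ, 0 < R ∧ SymplecticallyEmbeds (ball n R) U ∧ a = ENNReal.ofReal R}

/-- The cylindrical capacity `inf {R > 0 | U embeds symplectically into Z²ⁿ(R)}`, with values in
`[0, ∞]` (and `inf ∅ = ∞`). -/
noncomputable def cylindricalCapacity {n : ℕ} [NeZero n]
    (U : TopologicalSpace.Opens (PhaseSpace n)) : ℝ≥0∞ :=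
  sInf {a | ∃ R : ℝ, 0 < R ∧ SymplecticallyEmbeds U (cylinder n R) ∧ a = ENNReal.ofReal R}

/-- The `p`-sum `{(x, y) ∈ ℝ²ⁿ | ‖x‖ᵖ + ‖y‖ᵖ < 1}` of two Euclidean Lagrangian unit balls. -/
def lagrangianPSum (n : ℕ) (p : ℝ) (hp : 0 < p) : TopologicalSpace.Opens (PhaseSpace n) :=
  ⟨{z | ‖z.1‖ ^ p + ‖z.2‖ ^ p < 1},
    isOpen_lt ((continuous_fst.norm.rpow_const fun _ => Or.inr hp.le).add
      (continuous_snd.norm.rpow_const fun _ => Or.inr hp.le)) continuous_const⟩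

end SymplecticCapacity

/-! Monotonicity and rescaling give `Gr ≤ c ≤ c_Z` for every normalized capacity `c`, so it suffices
to embed balls of every capacity below `a_p` into `X_p`, and `X_p` into cylinders of every capacity
above `a_p`. Here `a_p` is the area `4 * lpSlice p 1` of the planar unit `ℓᵖ`-ball, whose Gamma
expression comes from the volume formula (`four_mul_lpSlice_one`). Both embeddings are cotangent
lifts `(x, y) ↦ (Φ x, (DΦ(x)ᵀ)⁻¹ y)` of maps of the base, built from a one-variable function `X`
that matches the areas under two planar profiles.

Cylinder: the pair `(x₁, y₁)` of a point of `X_p` lies in the planar `ℓᵖ`-ball. The lift of `x₁ ↦ X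
x₁` sends vertical slices of that ball into vertical slices of a slightly larger disc and leaves the
other coordinate pairs alone.

Ball: let `a` be the profile of the disc of radius `τ`, and `b` that of the `ℓᵖ`-ball. The lift of
the radial map with profile `X` acts on the fibre over `‖x‖ = r` with radial eigenvalue `1 / X' r`
and tangential eigenvalue `r / X r`. The image lies in `X_p` once both are at most `b (X r) / a r`.
The radial bound is the area matching; the tangential one says `r * a r ≤ X r * b (X r)`, a
comparison of inscribed rectangles (`mul_le_mul_lpProfile`).

For the rectangles, cut slices into a sector and half a rectangle. At equal sector area and equal
total area the `ℓᵖ`-ball has the larger rectangle (`sin_le_mul_lpProfile`). This reduces to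
convexity, up to the diagonal, of the angle `w` with `sin² w = xᵖ` as a function of sector area,
which is where `p ≥ 2` matters. Strict inequalities between areas pay for smoothing the profiles at
the origin. -/

namespace SymplecticCapacity

open Set Filter Topology
open scoped ContDiff

/-! ### Smoothing profiles and transporting area in one variable -/

section OneVariable

/-- A positive profile that is smooth off the origin can be replaced, up to a factor
arbitrarily close to one, by a smooth one that is constant near the origin. -/
lemma exists_flattening {f : ℝ → ℝ} {l η : ℝ} (hl : 0 < l) (hη : 0 < η) (hη1 : η < 1)
    (hf0 : ContinuousAt f 0) (hpos : ∀ s ∈ Ioo (-l) l, 0 < f s)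
    (hsm : ∀ s ∈ Ioo (-l) l, s ≠ 0 → ContDiffAt ℝ ∞ f s) :
    ∃ g : ℝ → ℝ, ContDiffOn ℝ ∞ g (Ioo (-l) l) ∧ (∃ c, ∀ᶠ s in 𝓝 0, g s = c) ∧
      (∀ s ∈ Ioo (-l) l, 0 < g s) ∧ ∀ s ∈ Ioo (-l) l, η * f s ≤ g s ∧ g s ≤ f s := by
  have h0 : (0 : ℝ) ∈ Ioo (-l) l := ⟨by linarith, hl⟩
  have hf : 0 < f 0 := hpos 0 h0
  -- A constant strictly between `η * f 0` and `f 0` stays between `η * f` and `f` near the origin,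
  -- so blending it into `f` by a bump function keeps both bounds.
  obtain ⟨c, hc1, hc2⟩ : ∃ c, η * f 0 < c ∧ c < f 0 :=
    exists_between (by nlinarith)
  have ev : ∀ᶠ s in 𝓝 (0 : ℝ), η * f s < c ∧ c < f s :=
    ((continuousAt_const.mul hf0).eventually_lt continuousAt_const hc1).and
      (continuousAt_const.eventually_lt hf0 hc2)
  obtain ⟨d, hd, hball⟩ := Metric.eventually_nhds_iff.1 ev
  let χ : ContDiffBump (0 : ℝ) := ⟨d / 2, d, by positivity, by linarith⟩
  have key : ∀ s ∈ Ioo (-l) l, η * f s ≤ χ s * c + (1 - χ s) * f s ∧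
      χ s * c + (1 - χ s) * f s ≤ f s := by
    intro s hs
    have hfs := hpos s hs
    have c0 : 0 ≤ χ s := χ.nonneg
    have c1 : χ s ≤ 1 := χ.le_one
    by_cases h : dist s 0 < d
    · obtain ⟨h1, h2⟩ := hball h
      constructor
      · nlinarith [mul_nonneg (sub_nonneg.2 c1) (mul_pos (sub_pos.2 hη1) hfs).le]
      · nlinarith
    · have : χ s = 0 := χ.zero_of_le_dist (not_lt.1 h)
      rw [this]
      constructor <;> nlinarith
  refine ⟨fun s => χ s * c + (1 - χ s) * f s, ?_, ⟨c, ?_⟩, ?_, key⟩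
  · intro s hs
    apply ContDiffAt.contDiffWithinAt
    by_cases h : s = 0
    · subst h
      refine (contDiffAt_const (c := c)).congr_of_eventuallyEq ?_
      filter_upwards [χ.eventuallyEq_one] with t ht
      have : χ t = 1 := ht
      simp [this]
    · exact (χ.contDiffAt.mul contDiffAt_const).add
        ((contDiffAt_const.sub χ.contDiffAt).mul (hsm s hs h))
  · filter_upwards [χ.eventuallyEq_one] with t ht
    have : χ t = 1 := ht
    simp [this]
  · intro s hs
    exact lt_of_lt_of_le (mul_pos hη (hpos s hs)) (key s hs).1

lemma intervalIntegrable_of_continuousOn_Ioo {f : ℝ → ℝ} {l x y : ℝ}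
    (hf : ContinuousOn f (Ioo (-l) l)) (hx : x ∈ Ioo (-l) l) (hy : y ∈ Ioo (-l) l) :
    IntervalIntegrable f MeasureTheory.volume x y :=
  (hf.mono (ordConnected_Ioo.uIcc_subset hx hy)).intervalIntegrable

lemma hasDerivAt_primitive {f : ℝ → ℝ} {l x : ℝ} (hf : ContinuousOn f (Ioo (-l) l))
    (hx : x ∈ Ioo (-l) l) : HasDerivAt (fun y => ∫ s in (0 : ℝ)..y, f s) (f x) x := by
  have h0 : (0 : ℝ) ∈ Ioo (-l) l := by
    obtain ⟨h1, h2⟩ := hx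
    constructor <;> linarith
  exact intervalIntegral.integral_hasDerivAt_right
    (intervalIntegrable_of_continuousOn_Ioo hf h0 hx)
    (hf.stronglyMeasurableAtFilter isOpen_Ioo x hx) (hf.continuousAt (isOpen_Ioo.mem_nhds hx))

lemma contDiffOn_primitive {f : ℝ → ℝ} {l : ℝ} (hf : ContDiffOn ℝ ∞ f (Ioo (-l) l)) :
    ContDiffOn ℝ ∞ (fun y => ∫ s in (0 : ℝ)..y, f s) (Ioo (-l) l) := by
  have hd := fun x hx => hasDerivAt_primitive (x := x) hf.continuousOn hx
  rw [contDiffOn_infty_iff_deriv_of_isOpen isOpen_Ioo]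
  exact ⟨fun x hx => (hd x hx).differentiableAt.differentiableWithinAt,
    hf.congr fun x hx => (hd x hx).deriv⟩

lemma strictMonoOn_primitive {f : ℝ → ℝ} {l : ℝ} (hf : ContinuousOn f (Ioo (-l) l))
    (hpos : ∀ s ∈ Ioo (-l) l, 0 < f s) :
    StrictMonoOn (fun y => ∫ s in (0 : ℝ)..y, f s) (Ioo (-l) l) := by
  refine strictMonoOn_of_deriv_pos (convex_Ioo _ _)
    (fun x hx => (hasDerivAt_primitive hf hx).continuousAt.continuousWithinAt) fun x hx => ?_
  rw [interior_Ioo] at hx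
  rw [(hasDerivAt_primitive hf hx).deriv]
  exact hpos x hx

/-- Solving `∫₀ˣ β = ∫₀ʳ α` for `x` as a smooth function of `r`. -/
lemma exists_smooth_transport {α β : ℝ → ℝ} {l m : ℝ} (hm : 0 < m)
    (hα : ContDiffOn ℝ ∞ α (Ioo (-l) l))
    (hβ : ContDiffOn ℝ ∞ β (Ioo (-m) m)) (hβ0 : ∀ s ∈ Ioo (-m) m, 0 < β s)
    (h : ∀ r ∈ Ioo (-l) l, ∃ x ∈ Ioo (-m) m, ∫ s in (0 : ℝ)..x, β s = ∫ s in (0 : ℝ)..r, α s) :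
    ∃ X : ℝ → ℝ, ContDiffOn ℝ ∞ X (Ioo (-l) l) ∧ X 0 = 0 ∧
      ∀ r ∈ Ioo (-l) l, X r ∈ Ioo (-m) m ∧ HasDerivAt X (α r / β (X r)) r ∧
        ∫ s in (0 : ℝ)..X r, β s = ∫ s in (0 : ℝ)..r, α s := by
  set A : ℝ → ℝ := fun r => ∫ s in (0 : ℝ)..r, α s with hA
  set B : ℝ → ℝ := fun r => ∫ s in (0 : ℝ)..r, β s with hB
  have hBinj : InjOn B (Ioo (-m) m) := (strictMonoOn_primitive hβ.continuousOn hβ0).injOn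
  set g := Function.invFunOn B (Ioo (-m) m) with hg
  have hgB : ∀ x ∈ Ioo (-m) m, g (B x) = x := fun x hx =>
    hBinj.leftInvOn_invFunOn hx
  have hgsm : ∀ x ∈ Ioo (-m) m, HasDerivAt g (β x)⁻¹ (B x) ∧ ContDiffAt ℝ ∞ g (B x) := by
    intro x hx
    have hev : ∀ᶠ y in 𝓝 x, g (B y) = y := by
      filter_upwards [isOpen_Ioo.mem_nhds hx] with y hy using hgB y hy
    have hBx : ContDiffAt ℝ ∞ B x := (contDiffOn_primitive hβ).contDiffAt (isOpen_Ioo.mem_nhds hx)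
    have hBd : HasDerivAt B (β x) x := hasDerivAt_primitive hβ.continuousOn hx
    have hBs : HasStrictDerivAt B (β x) x := hBx.hasStrictDerivAt' hBd (by simp)
    have hne := (hβ0 x hx).ne'
    refine ⟨(hBs.to_local_left_inverse hne hev).hasDerivAt, ?_⟩
    -- The inverse function theorem provides a smooth local inverse of `B`; local uniqueness
    -- identifies it with the global left inverse `g`.
    have hfd := (hBs.hasStrictFDerivAt_equiv hne)
    have := hBx.to_localInverse hfd.hasFDerivAt (by simp)
    refine this.congr_of_eventuallyEq ?_
    exact hfd.localInverse_unique hev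
  have hsol : ∀ r ∈ Ioo (-l) l, g (A r) ∈ Ioo (-m) m ∧ B (g (A r)) = A r := by
    intro r hr
    obtain ⟨x, hx, hxr⟩ := h r hr
    have hxr' : B x = A r := hxr
    rw [← hxr', hgB x hx]
    exact ⟨hx, rfl⟩
  refine ⟨g ∘ A, ?_, ?_, ?_⟩
  · intro r hr
    obtain ⟨h1, h2⟩ := hsol r hr
    have := (hgsm _ h1).2
    rw [h2] at this
    exact (this.comp r ((contDiffOn_primitive hα).contDiffAt
      (isOpen_Ioo.mem_nhds hr))).contDiffWithinAt
  · have : A 0 = B 0 := by simp [hA, hB]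
    simp only [Function.comp, this]
    exact hgB 0 ⟨by linarith, hm⟩
  · intro r hr
    obtain ⟨h1, h2⟩ := hsol r hr
    refine ⟨h1, ?_, h2⟩
    have := (hgsm _ h1).1
    rw [h2] at this
    have h3 := this.comp r (hasDerivAt_primitive hα.continuousOn hr)
    rw [div_eq_inv_mul]
    exact h3

/-- Smooth transport between two profiles that are comparable to even profiles `a` and `b`. -/
lemma exists_smooth_transport_of_le {α β a b : ℝ → ℝ} {l m C η : ℝ} (hl : 0 < l) (hm : 0 < m)
    (hC : 0 ≤ C) (ha : Continuous a) (hb : Continuous b) (haeven : ∀ s, a (-s) = a s)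
    (hbeven : ∀ s, b (-s) = b s) (hanonneg : ∀ s ∈ Ioo (-l) l, 0 ≤ a s)
    (hα : ContDiffOn ℝ ∞ α (Ioo (-l) l)) (hα0 : ∀ s ∈ Ioo (-l) l, 0 < α s)
    (hβ : ContDiffOn ℝ ∞ β (Ioo (-m) m)) (hβ0 : ∀ s ∈ Ioo (-m) m, 0 < β s)
    (hαa : ∀ s ∈ Ioo (-l) l, α s ≤ C * a s) (hβb : ∀ s ∈ Ioo (-m) m, η * b s ≤ β s)
    (hlt : C * ∫ s in (0 : ℝ)..l, a s < η * ∫ s in (0 : ℝ)..m, b s) :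
    ∃ X : ℝ → ℝ, ContDiffOn ℝ ∞ X (Ioo (-l) l) ∧ X 0 = 0 ∧
      ∀ r ∈ Ioo (-l) l, X r ∈ Ioo (-m) m ∧ HasDerivAt X (α r / β (X r)) r ∧
        ∫ s in (0 : ℝ)..X r, β s = ∫ s in (0 : ℝ)..r, α s := by
  refine exists_smooth_transport hm hα hβ hβ0 fun r hr => ?_
  have h0l : (0 : ℝ) ∈ Ioo (-l) l := ⟨by linarith, hl⟩
  have h0m : (0 : ℝ) ∈ Ioo (-m) m := ⟨by linarith, hm⟩
  have bound : ∀ f : ℝ → ℝ, ContinuousOn f (Ioo (-l) l) → (∀ s ∈ Ioo (-l) l, f s ≤ C * a s) →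
      ∀ t, 0 ≤ t → t < l → ∫ s in (0 : ℝ)..t, f s ≤ C * ∫ s in (0 : ℝ)..l, a s := by
    intro f hf hfa t ht htl
    have ht' : t ∈ Ioo (-l) l := ⟨by linarith, htl⟩
    calc ∫ s in (0 : ℝ)..t, f s ≤ ∫ s in (0 : ℝ)..t, C * a s :=
          intervalIntegral.integral_mono_on ht (intervalIntegrable_of_continuousOn_Ioo hf h0l ht')
            ((continuous_const.mul ha).intervalIntegrable _ _)
            fun s hs => hfa s ⟨by linarith [hs.1], by linarith [hs.2]⟩
      _ = C * ∫ s in (0 : ℝ)..t, a s := intervalIntegral.integral_const_mul _ _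
      _ ≤ C * ∫ s in (0 : ℝ)..l, a s := by
          refine mul_le_mul_of_nonneg_left ?_ hC
          rw [← intervalIntegral.integral_add_adjacent_intervals (ha.intervalIntegrable 0 t)
            (ha.intervalIntegrable t l), le_add_iff_nonneg_right]
          -- The sign of `a` is only given on the open interval; the endpoint is a null set.
          refine intervalIntegral.integral_nonneg_of_ae_restrict htl.le ?_
          rw [← MeasureTheory.restrict_Ioo_eq_restrict_Icc]
          exact (MeasureTheory.ae_restrict_mem measurableSet_Ioo).mono fun s hs =>
            hanonneg s ⟨by linarith [hs.1], hs.2⟩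
  have habs : |∫ s in (0 : ℝ)..r, α s| ≤ C * ∫ s in (0 : ℝ)..l, a s := by
    rcases le_total 0 r with h | h
    · rw [abs_of_nonneg (intervalIntegral.integral_nonneg h fun s hs =>
        (hα0 s ⟨by linarith [hs.1], by linarith [hs.2, hr.2]⟩).le)]
      exact bound α hα.continuousOn hαa r h hr.2
    · have h2 : ∫ s in (0 : ℝ)..r, α s = -∫ s in (0 : ℝ)..(-r), α (-s) := by
        rw [intervalIntegral.integral_comp_neg, intervalIntegral.integral_symm]; simp
      have hneg : ∀ s ∈ Ioo (-l) l, -s ∈ Ioo (-l) l := fun s hs =>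
        ⟨by linarith [hs.2], by linarith [hs.1]⟩
      rw [h2, abs_neg, abs_of_nonneg (intervalIntegral.integral_nonneg (by linarith) fun s hs =>
        (hα0 (-s) ⟨by linarith [hs.2, hr.1], by linarith [hs.1]⟩).le)]
      refine bound (fun s => α (-s)) (hα.continuousOn.comp continuousOn_neg hneg) ?_ (-r)
        (by linarith) (by linarith [hr.1])
      intro s hs
      simpa only [haeven] using hαa (-s) (hneg s hs)
  have hcont : Continuous fun x => η * ∫ s in (0 : ℝ)..x, b s :=
    continuous_const.mul (intervalIntegral.continuous_primitive (fun _ _ =>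
      hb.intervalIntegrable _ _) 0)
  -- The strict inequality of total areas survives at some `x < m`, so the intermediate value
  -- theorem can be applied on `[-x, x]`, inside the interval where `β` is controlled.
  have hev : ∀ᶠ x in 𝓝[<] m, |∫ s in (0 : ℝ)..r, α s| < η * ∫ s in (0 : ℝ)..x, b s :=
    (hcont.continuousAt.eventually (lt_mem_nhds (habs.trans_lt hlt))).filter_mono
      nhdsWithin_le_nhds
  obtain ⟨x, hx, hx0, hxm⟩ := (hev.and (Ioo_mem_nhdsLT hm)).exists
  have hxI : x ∈ Ioo (-m) m := ⟨by linarith, hxm⟩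
  have hnxI : -x ∈ Ioo (-m) m := ⟨by linarith, by linarith⟩
  have lower : ∀ f : ℝ → ℝ, ContinuousOn f (Ioo (-m) m) → (∀ s ∈ Ioo (-m) m, η * b s ≤ f s) →
      η * ∫ s in (0 : ℝ)..x, b s ≤ ∫ s in (0 : ℝ)..x, f s := by
    intro f hf hfb
    rw [← intervalIntegral.integral_const_mul]
    exact intervalIntegral.integral_mono_on hx0.le
      ((continuous_const.mul hb).intervalIntegrable _ _)
      (intervalIntegrable_of_continuousOn_Ioo hf h0m hxI)
      fun s hs => hfb s ⟨by linarith [hs.1], by linarith [hs.2]⟩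
  have hup := lower β hβ.continuousOn hβb
  have hlo : ∫ s in (0 : ℝ)..(-x), β s ≤ -(η * ∫ s in (0 : ℝ)..x, b s) := by
    have hneg : ∀ s ∈ Ioo (-m) m, -s ∈ Ioo (-m) m := fun s hs =>
      ⟨by linarith [hs.2], by linarith [hs.1]⟩
    have h2 : ∫ s in (0 : ℝ)..(-x), β s = -∫ s in (0 : ℝ)..x, β (-s) := by
      rw [intervalIntegral.integral_comp_neg, intervalIntegral.integral_symm]; simp
    rw [h2]
    refine neg_le_neg (lower (fun s => β (-s)) (hβ.continuousOn.comp continuousOn_neg hneg) ?_)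
    intro s hs
    simpa only [hbeven] using hβb (-s) (hneg s hs)
  have hsub : Icc (-x) x ⊆ Ioo (-m) m := fun s hs =>
    ⟨by linarith [hs.1, hnxI.1], by linarith [hs.2]⟩
  have hivt := intermediate_value_Icc (a := -x) (b := x) (by linarith)
    (f := fun y => ∫ s in (0 : ℝ)..y, β s) fun y hy =>
      (hasDerivAt_primitive hβ.continuousOn (hsub hy)).continuousAt.continuousWithinAt
  obtain ⟨y, hy, hyr⟩ := hivt (show ∫ s in (0 : ℝ)..r, α s ∈ Icc _ _ by
    obtain ⟨h1, h2⟩ := abs_lt.1 hx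
    exact ⟨by linarith, by linarith⟩)
  exact ⟨y, hsub hy, hyr⟩

/-- Flattened profiles make the derivative of the transport constant near the origin; the resulting
linearity makes the associated radial map smooth there. -/
lemma eventually_eq_mul_of_hasDerivAt {X X' : ℝ → ℝ} {k : ℝ} (h0 : X 0 = 0)
    (hX : ∀ᶠ r in 𝓝 0, HasDerivAt X (X' r) r) (hk : ∀ᶠ r in 𝓝 0, X' r = k) :
    ∀ᶠ r in 𝓝 0, X r = k * r := by
  obtain ⟨d, hd, hball⟩ := Metric.eventually_nhds_iff_ball.1 (hX.and hk)
  have hder : ∀ r ∈ Metric.ball (0 : ℝ) d, HasDerivAt (fun r => X r - k * r) 0 r := by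
    intro r hr
    have := (hball r hr).1.sub ((hasDerivAt_id r).const_mul k)
    rw [(hball r hr).2] at this
    simpa [Pi.sub_def] using this
  filter_upwards [Metric.ball_mem_nhds (0 : ℝ) hd] with r hr
  have := Metric.isOpen_ball.is_const_of_deriv_eq_zero (𝕜 := ℝ)
    (convex_ball (0 : ℝ) d).isPreconnected
    (fun r hr => (hder r hr).differentiableAt.differentiableWithinAt)
    (fun r hr => (hder r hr).deriv) hr (Metric.mem_ball_self hd)
  simp only [h0] at this
  linarith

end OneVariable

/-! ### Cotangent lifts are symplectic -/

section CotangentLift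

lemma omega_eq_inner {n : ℕ} (u v : PhaseSpace n) :
    omega u v = inner ℝ u.1 v.2 - inner ℝ v.1 u.2 := by
  simp only [omega, PiLp.inner_apply, RCLike.inner_apply, conj_trivial, ← Finset.sum_sub_distrib]
  exact Finset.sum_congr rfl fun i _ => by ring

/-- The lift `(x, y) ↦ (Φ x, (DΦ(x)ᵀ)⁻¹ y)` of a smooth embedding of the base is symplectic. -/
lemma symplecticallyEmbeds_of_cotangentLift {n : ℕ} {U V : TopologicalSpace.Opens (PhaseSpace n)}
    {W : Set (EuclideanSpace ℝ (Fin n))} (hW : IsOpen W)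
    {Φ : EuclideanSpace ℝ (Fin n) → EuclideanSpace ℝ (Fin n)}
    {M : EuclideanSpace ℝ (Fin n) → EuclideanSpace ℝ (Fin n) →L[ℝ] EuclideanSpace ℝ (Fin n)}
    (hΦ : ContDiffOn ℝ ∞ Φ W) (hM : ContDiffOn ℝ ∞ M W) (hinj : InjOn Φ W)
    (hdual : ∀ x ∈ W, ∀ u y, inner ℝ (fderiv ℝ Φ x u) (M x y) = inner ℝ u y)
    (hU : ∀ z ∈ U, z.1 ∈ W) (hmaps : ∀ z ∈ U, (Φ z.1, M z.1 z.2) ∈ V) :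
    SymplecticallyEmbeds U V := by
  refine ⟨fun z => (Φ z.1, M z.1 z.2), ?_, hmaps, ?_, ?_⟩
  · have h1 : ContDiffOn ℝ ∞ (fun z : PhaseSpace n => Φ z.1) U := hΦ.comp contDiffOn_fst hU
    have h2 : ContDiffOn ℝ ∞ (fun z : PhaseSpace n => M z.1) U := hM.comp contDiffOn_fst hU
    exact h1.prodMk (h2.clm_apply contDiffOn_snd)
  · rintro ⟨x, y⟩ hz ⟨x', y'⟩ hz' h
    simp only [Prod.mk.injEq] at h
    obtain ⟨h1, h2⟩ := h
    have hx := hU _ hz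
    obtain rfl : x = x' := hinj hx (hU _ hz') h1
    congr 1
    refine ext_inner_left ℝ fun u => ?_
    rw [← hdual x hx u y, ← hdual x hx u y', h2]
  · rintro ⟨x, y⟩ hz u v
    have hx : x ∈ W := hU _ hz
    have hWx := hW.mem_nhds hx
    have hΦx : ContDiffAt ℝ ∞ Φ x := hΦ.contDiffAt hWx
    have hMx : ContDiffAt ℝ ∞ M x := hM.contDiffAt hWx
    have dΦ : HasFDerivAt Φ (fderiv ℝ Φ x) x := (hΦx.differentiableAt (by simp)).hasFDerivAt
    have dM : HasFDerivAt M (fderiv ℝ M x) x := (hMx.differentiableAt (by simp)).hasFDerivAt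
    have ddΦ : HasFDerivAt (fderiv ℝ Φ) (fderiv ℝ (fderiv ℝ Φ) x) x :=
      ((hΦx.fderiv_right (m := 1) (by norm_cast)).differentiableAt (by simp)).hasFDerivAt
    let p₁ := ContinuousLinearMap.fst ℝ (EuclideanSpace ℝ (Fin n)) (EuclideanSpace ℝ (Fin n))
    let p₂ := ContinuousLinearMap.snd ℝ (EuclideanSpace ℝ (Fin n)) (EuclideanSpace ℝ (Fin n))
    have hf : HasFDerivAt (fun z : PhaseSpace n => (Φ z.1, M z.1 z.2))
        (((fderiv ℝ Φ x).comp p₁).prod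
          ((M x).comp p₂ +
            ((fderiv ℝ M x).comp p₁).flip y)) (x, y) := by
      refine HasFDerivAt.prodMk ?_ ?_
      · exact HasFDerivAt.comp (x, y) (f := Prod.fst) (g := Φ) dΦ hasFDerivAt_fst
      · have h1 : HasFDerivAt (fun z : PhaseSpace n => M z.1)
            ((fderiv ℝ M x).comp p₁) (x, y) :=
          HasFDerivAt.comp (x, y) (f := Prod.fst) (g := M) dM hasFDerivAt_fst
        exact h1.clm_apply hasFDerivAt_snd
    -- The derivative in direction `b` of the constant pairing `⟨DΦ(x) a, M(x) y⟩ = ⟨a, y⟩`.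
    have key : ∀ a b, inner ℝ (fderiv ℝ (fderiv ℝ Φ) x b a) (M x y) +
        inner ℝ (fderiv ℝ Φ x a) (fderiv ℝ M x b y) = 0 := by
      intro a b
      have h1 : HasFDerivAt (fun x => inner ℝ (fderiv ℝ Φ x a) (M x y)) _ x :=
        (ddΦ.clm_apply (hasFDerivAt_const a x)).inner ℝ (dM.clm_apply (hasFDerivAt_const y x))
      have h2 : HasFDerivAt (fun x => inner ℝ (fderiv ℝ Φ x a) (M x y))
          (0 : EuclideanSpace ℝ (Fin n) →L[ℝ] ℝ) x := by
        refine (hasFDerivAt_const (inner ℝ a y : ℝ) x).congr_of_eventuallyEq ?_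
        filter_upwards [hWx] with x' hx' using hdual x' hx' a y
      have h3 := congrArg (fun T => T b) (h1.unique h2)
      simp [fderivInnerCLM_apply] at h3
      linarith
    -- By `key`, the terms of the pullback containing `DM` become second derivatives of `Φ`, which
    -- cancel by symmetry.
    have hsymm := (hΦx.isSymmSndFDerivAt (by
      rw [minSmoothness_of_isRCLikeNormedField]
      exact WithTop.coe_le_coe.2 (le_top (a := (2 : ℕ∞))))).eq u.1 v.1
    rw [hf.fderiv, omega_eq_inner, omega_eq_inner]
    have k1 := key u.1 v.1
    have k2 := key v.1 u.1
    rw [hsymm] at k2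
    simp only [p₁, p₂, ContinuousLinearMap.prod_apply, ContinuousLinearMap.comp_apply,
      add_apply, ContinuousLinearMap.flip_apply, ContinuousLinearMap.coe_fst',
      ContinuousLinearMap.coe_snd', inner_add_right, hdual x hx]
    linarith

end CotangentLift

/-! ### Radial maps and their inverse transposes -/

section Radial

variable {E : Type*} [NormedAddCommGroup E] [InnerProductSpace ℝ E]

/-- The linear map with eigenvalue `s` on the line of `x` and `t` on its orthogonal complement. -/
noncomputable def radialScaling (s t : ℝ) (x : E) : E →L[ℝ] E :=
  t • ContinuousLinearMap.id ℝ E + ((s - t) / ‖x‖ ^ 2) • (innerSL ℝ x).smulRight x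

lemma radialScaling_apply (s t : ℝ) (x u : E) :
    radialScaling s t x u = t • u + ((s - t) / ‖x‖ ^ 2 * inner ℝ x u) • x := by
  simp [radialScaling, smul_smul]

/-- The two maps are self-adjoint with the same eigenspaces and reciprocal eigenvalues. At `x = 0`
the rank-one term vanishes and only `t` remains. -/
lemma inner_radialScaling_inv {s t : ℝ} (hs : s ≠ 0) (ht : t ≠ 0) (x u y : E) :
    inner ℝ (radialScaling s t x u) (radialScaling s⁻¹ t⁻¹ x y) = inner ℝ u y := by
  simp only [radialScaling_apply, inner_add_left, inner_add_right, inner_smul_left,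
    inner_smul_right, conj_trivial, real_inner_self_eq_norm_sq, real_inner_comm x u]
  by_cases hx : x = 0
  · simp [hx, ht]
  · have : ‖x‖ ≠ 0 := norm_ne_zero_iff.2 hx
    field_simp
    ring

/-- Split `y` along `x` and its orthogonal complement: the squared norm is `s ^ 2` and `t ^ 2` times
the squared norms of the two parts. -/
lemma norm_radialScaling_le {s t C : ℝ} (hs : 0 ≤ s) (ht : 0 ≤ t) (hsC : s ≤ C) (htC : t ≤ C)
    (x y : E) : ‖radialScaling s t x y‖ ≤ C * ‖y‖ := by
  have hC : 0 ≤ C := hs.trans hsC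
  refine abs_le_of_sq_le_sq' ?_ (by positivity) |>.2
  by_cases hx : x = 0
  · simp only [radialScaling_apply, hx, smul_zero, add_zero, norm_smul, Real.norm_eq_abs,
      abs_of_nonneg ht]
    gcongr
  have hx' : ‖x‖ ≠ 0 := norm_ne_zero_iff.2 hx
  have hcs : inner ℝ x y ^ 2 ≤ ‖x‖ ^ 2 * ‖y‖ ^ 2 := by
    rw [← mul_pow, ← sq_abs]
    exact pow_le_pow_left₀ (abs_nonneg _) (abs_real_inner_le_norm x y) 2
  have hq : 0 ≤ inner ℝ x y ^ 2 / ‖x‖ ^ 2 := by positivity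
  have hq' : inner ℝ x y ^ 2 / ‖x‖ ^ 2 ≤ ‖y‖ ^ 2 := by
    rw [div_le_iff₀ (by positivity)]; linarith
  have : ‖radialScaling s t x y‖ ^ 2 =
      t ^ 2 * (‖y‖ ^ 2 - inner ℝ x y ^ 2 / ‖x‖ ^ 2) + s ^ 2 * (inner ℝ x y ^ 2 / ‖x‖ ^ 2) := by
    rw [← real_inner_self_eq_norm_sq, radialScaling_apply]
    simp only [inner_add_left, inner_add_right, inner_smul_left,
      inner_smul_right, conj_trivial, real_inner_self_eq_norm_sq, real_inner_comm x y]
    field_simp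
    ring
  rw [this, mul_pow]
  have e1 : s ^ 2 ≤ C ^ 2 := pow_le_pow_left₀ hs hsC 2
  have e2 : t ^ 2 ≤ C ^ 2 := pow_le_pow_left₀ ht htC 2
  nlinarith [mul_le_mul_of_nonneg_right e1 hq, mul_le_mul_of_nonneg_right e2 (sub_nonneg.2 hq')]

lemma hasFDerivAt_norm_of_ne_zero {x : E} (hx : x ≠ 0) :
    HasFDerivAt (fun x : E => ‖x‖) (‖x‖⁻¹ • innerSL ℝ x) x := by
  have hx' : ‖x‖ ≠ 0 := norm_ne_zero_iff.2 hx
  have h := (Real.hasDerivAt_sqrt (pow_ne_zero 2 hx')).comp_hasFDerivAt x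
    (hasStrictFDerivAt_norm_sq x).hasFDerivAt
  have e : (Real.sqrt ∘ fun x : E => ‖x‖ ^ 2) = fun x => ‖x‖ := by
    ext y; simp
  rw [e] at h
  refine h.congr_fderiv ?_
  rw [Real.sqrt_sq (norm_nonneg x)]
  ext u
  simp
  field_simp

/-- The radial map with profile `X`, and the inverse transpose of its derivative, when `X` is linear
near the origin. -/
lemma exists_radial_map {X : ℝ → ℝ} {l k : ℝ} (hl : 0 < l) (hk : 0 < k)
    (hX : ContDiffOn ℝ ∞ X (Ioo (-l) l)) (hX' : ∀ r ∈ Ioo (-l) l, 0 < deriv X r)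
    (hlin : ∀ᶠ r in 𝓝 0, X r = k * r) :
    ∃ (Φ : E → E) (M : E → E →L[ℝ] E), ContDiffOn ℝ ∞ Φ (Metric.ball 0 l) ∧
      ContDiffOn ℝ ∞ M (Metric.ball 0 l) ∧ InjOn Φ (Metric.ball 0 l) ∧
      (∀ x ∈ Metric.ball (0 : E) l, ∀ u y, inner ℝ (fderiv ℝ Φ x u) (M x y) = inner ℝ u y) ∧
      ∀ x ∈ Metric.ball (0 : E) l, ‖Φ x‖ = X ‖x‖ ∧
        ∀ C, (deriv X ‖x‖)⁻¹ ≤ C → ‖x‖ ≤ C * X ‖x‖ → ∀ y, ‖M x y‖ ≤ C * ‖y‖ := by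
  have h0l : (0 : ℝ) ∈ Ioo (-l) l := ⟨by linarith, hl⟩
  have hX0 : X 0 = 0 := by simpa using hlin.self_of_nhds
  have hmem : ∀ x ∈ Metric.ball (0 : E) l, ‖x‖ ∈ Ioo (-l) l := fun x hx =>
    ⟨by linarith [norm_nonneg x], by simpa using hx⟩
  have hmono : StrictMonoOn X (Ioo (-l) l) :=
    strictMonoOn_of_deriv_pos (convex_Ioo _ _) hX.continuousOn (by simpa using hX')
  have hXpos : ∀ r ∈ Ioo (-l) l, 0 < r → 0 < X r := fun r hr h0 => by
    simpa [hX0] using hmono h0l hr h0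
  have hdX : ∀ r ∈ Ioo (-l) l, HasDerivAt X (deriv X r) r := fun r hr =>
    ((hX.contDiffAt (isOpen_Ioo.mem_nhds hr)).differentiableAt (by simp)).hasDerivAt
  have hdlin : ∀ᶠ r in 𝓝 0, deriv X r = k := by
    filter_upwards [hlin.eventually_nhds] with r hr
    have : X =ᶠ[𝓝 r] fun s => k * s := hr
    rw [this.deriv_eq]
    simp
  -- The tangential stretch of the radial map `x ↦ g ‖x‖ • x`; the value `k` at zero is its limit.
  set g : ℝ → ℝ := fun r => if r = 0 then k else X r / r with hg
  have hglin : ∀ᶠ r in 𝓝 0, g r = k := by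
    filter_upwards [hlin] with r hr
    by_cases h : r = 0
    · simp [hg, h]
    · simp [hg, h, hr]
  have hgpos : ∀ r ∈ Ioo (-l) l, 0 ≤ r → 0 < g r := by
    intro r hr h0
    rcases h0.eq_or_lt with h | h
    · simp [hg, ← h, hk]
    · simp only [hg, h.ne', if_false]
      exact div_pos (hXpos r hr h) h
  have hgX : ∀ r, g r * r = X r := by
    intro r
    by_cases h : r = 0
    · simp [hg, h, hX0]
    · simp [hg, h]
  have norm_tendsto : Tendsto (fun x : E => ‖x‖) (𝓝 0) (𝓝 0) := by
    simpa using (continuous_norm (E := E)).tendsto 0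
  have hgne : ∀ x : E, x ≠ 0 → (fun x : E => g ‖x‖) =ᶠ[𝓝 x] fun x => X ‖x‖ / ‖x‖ := by
    intro x hx
    filter_upwards [isOpen_ne.mem_nhds hx] with y hy
    simp [hg, hy]
  have hXn : ∀ x ∈ Metric.ball (0 : E) l, x ≠ 0 → ContDiffAt ℝ ∞ (fun x : E => X ‖x‖) x :=
    fun x hx hx0 => (hX.contDiffAt (isOpen_Ioo.mem_nhds (hmem x hx))).comp x
      (contDiffAt_norm ℝ hx0)
  have hgsm : ∀ x ∈ Metric.ball (0 : E) l, ContDiffAt ℝ ∞ (fun x : E => g ‖x‖) x := by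
    intro x hx
    by_cases hx0 : x = 0
    · subst hx0
      refine (contDiffAt_const (c := k)).congr_of_eventuallyEq ?_
      exact norm_tendsto.eventually hglin
    · exact ((hXn x hx hx0).div (contDiffAt_norm ℝ hx0)
        (norm_ne_zero_iff.2 hx0)).congr_of_eventuallyEq (hgne x hx0)
  have hfd : ∀ x ∈ Metric.ball (0 : E) l,
      fderiv ℝ (fun x : E => g ‖x‖ • x) x = radialScaling (deriv X ‖x‖) (g ‖x‖) x := by
    intro x hx
    by_cases hx0 : x = 0
    · subst hx0
      have h1 : (fun x : E => g ‖x‖ • x) =ᶠ[𝓝 0] fun x => k • x := by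
        filter_upwards [norm_tendsto.eventually hglin] with y hy
        simp [hy]
      rw [h1.fderiv_eq]
      have h2 : HasFDerivAt (fun x : E => k • x) (k • ContinuousLinearMap.id ℝ E) 0 :=
        (hasFDerivAt_id (𝕜 := ℝ) (0 : E)).const_smul k
      rw [h2.fderiv]
      ext u
      simp [radialScaling_apply, hg]
    · have hx' : ‖x‖ ≠ 0 := norm_ne_zero_iff.2 hx0
      have hn := hasFDerivAt_norm_of_ne_zero hx0
      have hq := ((hdX _ (hmem x hx)).div (hasDerivAt_id ‖x‖) hx').comp_hasFDerivAt x hn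
      have h1 : HasFDerivAt (fun x : E => g ‖x‖ • x) _ x :=
        (hq.congr_of_eventuallyEq (hgne x hx0)).smul (hasFDerivAt_id (𝕜 := ℝ) x)
      rw [h1.fderiv]
      ext u
      simp only [radialScaling_apply, hg, hx', if_false]
      simp [smul_smul]
      congr 1
      field_simp
  refine ⟨fun x => g ‖x‖ • x, fun x => radialScaling (deriv X ‖x‖)⁻¹ (g ‖x‖)⁻¹ x, ?_, ?_, ?_, ?_, ?_⟩
  · exact fun x hx => ((hgsm x hx).smul contDiffAt_id).contDiffWithinAt
  · intro x hx
    apply ContDiffAt.contDiffWithinAt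
    by_cases hx0 : x = 0
    · subst hx0
      -- Near the origin both eigenvalues equal `k⁻¹`, so the singular rank-one term has coefficient
      -- zero.
      refine (contDiffAt_const (c := k⁻¹ • ContinuousLinearMap.id ℝ E)).congr_of_eventuallyEq ?_
      filter_upwards [norm_tendsto.eventually hglin, norm_tendsto.eventually hdlin] with y h1 h2
      simp [radialScaling, h1, h2]
    · have hd : ContDiffAt ℝ ∞ (fun x : E => deriv X ‖x‖) x := by
        refine ContDiffAt.comp x (g := deriv X) ?_ (contDiffAt_norm ℝ hx0)
        exact ((contDiffOn_infty_iff_deriv_of_isOpen isOpen_Ioo).1 hX).2.contDiffAt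
          (isOpen_Ioo.mem_nhds (hmem x hx))
      have hx' : ‖x‖ ≠ 0 := norm_ne_zero_iff.2 hx0
      have hgi := (hgsm x hx).inv (hgpos _ (hmem x hx) (norm_nonneg x)).ne'
      have hdi := hd.inv (hX' _ (hmem x hx)).ne'
      unfold radialScaling
      refine (hgi.smul contDiffAt_const).add ?_
      refine ((hdi.sub hgi).div ((contDiffAt_norm ℝ hx0).pow 2) (pow_ne_zero 2 hx')).smul ?_
      exact ((innerSL ℝ).contDiff.contDiffAt).smulRight contDiffAt_id
  · intro x hx y hy h
    have hnorm : ∀ x ∈ Metric.ball (0 : E) l, ‖g ‖x‖ • x‖ = X ‖x‖ := fun x hx => by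
      rw [norm_smul, Real.norm_eq_abs, abs_of_pos (hgpos _ (hmem x hx) (norm_nonneg x)), hgX]
    have h1 : ‖x‖ = ‖y‖ := hmono.injOn (hmem x hx) (hmem y hy) (by
      rw [← hnorm x hx, ← hnorm y hy]; exact congrArg norm h)
    have h2 : g ‖x‖ • x = g ‖y‖ • y := h
    rw [h1] at h2
    exact smul_right_injective E (hgpos _ (hmem y hy) (norm_nonneg y)).ne' h2
  · intro x hx u y
    rw [hfd x hx]
    exact inner_radialScaling_inv (hX' _ (hmem x hx)).ne'
      (hgpos _ (hmem x hx) (norm_nonneg x)).ne' x u y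
  · intro x hx
    have hgp := hgpos _ (hmem x hx) (norm_nonneg x)
    refine ⟨?_, fun C h1 h2 y => ?_⟩
    · rw [norm_smul, Real.norm_eq_abs, abs_of_pos hgp, hgX]
    · have hd := hX' _ (hmem x hx)
      refine norm_radialScaling_le (inv_nonneg.2 hd.le) (inv_nonneg.2 hgp.le) h1 ?_ x y
      -- At the origin `‖x‖ ≤ C * X ‖x‖` is vacuous, but there the tangential and radial eigenvalues
      -- agree.
      by_cases hx0 : ‖x‖ = 0
      · rw [hx0] at h1 ⊢
        rw [hglin.self_of_nhds, ← hdlin.self_of_nhds]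
        exact h1
      · rw [← hgX, ← mul_assoc] at h2
        have hxp : 0 < ‖x‖ := lt_of_le_of_ne (norm_nonneg x) (Ne.symm hx0)
        rw [inv_le_iff_one_le_mul₀ hgp]
        exact le_of_mul_le_mul_right (by linarith) hxp

end Radial

/-! ### Slices and sectors of the planar `ℓᵖ`-ball -/

section Profile

/-- The upper boundary `s ↦ (1 - |s|ᵖ)^(1/p)` of the planar unit `ℓᵖ`-ball. -/
noncomputable def lpProfile (p s : ℝ) : ℝ := (1 - |s| ^ p) ^ (1 / p)

/-- The area below the boundary of the planar unit `ℓᵖ`-ball, between `0` and `x`. -/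
noncomputable def lpSlice (p x : ℝ) : ℝ := ∫ s in (0 : ℝ)..x, lpProfile p s

/-- The area of the sector of the planar unit `ℓᵖ`-ball between the vertical axis and the ray
through `(x, lpProfile p x)`. -/
noncomputable def lpSector (p x : ℝ) : ℝ := lpSlice p x - x * lpProfile p x / 2

variable {p : ℝ}

lemma continuous_lpProfile (hp : 2 ≤ p) : Continuous (lpProfile p) := by
  have h1 : Continuous fun s : ℝ => |s| ^ p :=
    continuous_abs.rpow_const fun _ => Or.inr (by linarith)
  exact (continuous_const.sub h1).rpow_const fun _ => Or.inr (by positivity)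

lemma lpProfile_neg (s : ℝ) : lpProfile p (-s) = lpProfile p s := by simp [lpProfile]

lemma lpProfile_zero (hp : 2 ≤ p) : lpProfile p 0 = 1 := by
  simp [lpProfile, Real.zero_rpow (by linarith : p ≠ 0)]

lemma lpProfile_one (hp : 2 ≤ p) : lpProfile p 1 = 0 := by
  have : p⁻¹ ≠ 0 := inv_ne_zero (by linarith)
  simp [lpProfile, Real.zero_rpow this]

lemma abs_rpow_lt_one (hp : 2 ≤ p) {s : ℝ} (hs : s ∈ Ioo (-1 : ℝ) 1) : |s| ^ p < 1 :=
  Real.rpow_lt_one (abs_nonneg s) (abs_lt.2 hs) (by linarith)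

lemma lpProfile_pos (hp : 2 ≤ p) {s : ℝ} (hs : s ∈ Ioo (-1 : ℝ) 1) : 0 < lpProfile p s :=
  Real.rpow_pos_of_pos (by linarith [abs_rpow_lt_one hp hs]) _

lemma rpow_le_one_of_mem (hp : 2 ≤ p) {s : ℝ} (hs : s ∈ Icc (0 : ℝ) 1) : s ^ p ≤ 1 :=
  Real.rpow_le_one hs.1 hs.2 (by linarith)

lemma lpProfile_of_nonneg {s : ℝ} (hs : 0 ≤ s) : lpProfile p s = (1 - s ^ p) ^ (1 / p) := by
  rw [lpProfile, abs_of_nonneg hs]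

lemma lpProfile_mem (hp : 2 ≤ p) {s : ℝ} (hs : s ∈ Icc (0 : ℝ) 1) :
    lpProfile p s ∈ Icc (0 : ℝ) 1 := by
  have h1 := rpow_le_one_of_mem hp hs
  have h2 : 0 ≤ s ^ p := Real.rpow_nonneg hs.1 p
  rw [lpProfile_of_nonneg hs.1]
  exact ⟨Real.rpow_nonneg (by linarith) _,
    Real.rpow_le_one (by linarith) (by linarith) (by positivity)⟩

lemma lpProfile_rpow (hp : 2 ≤ p) {s : ℝ} (hs : s ∈ Icc (0 : ℝ) 1) :
    lpProfile p s ^ p = 1 - s ^ p := by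
  have h1 := rpow_le_one_of_mem hp hs
  rw [lpProfile_of_nonneg hs.1, ← Real.rpow_mul (by linarith), one_div,
    inv_mul_cancel₀ (by linarith), Real.rpow_one]

lemma lpProfile_lpProfile (hp : 2 ≤ p) {s : ℝ} (hs : s ∈ Icc (0 : ℝ) 1) :
    lpProfile p (lpProfile p s) = s := by
  rw [lpProfile_of_nonneg (lpProfile_mem hp hs).1, lpProfile_rpow hp hs, sub_sub_cancel,
    ← Real.rpow_mul hs.1, one_div, mul_inv_cancel₀ (by linarith), Real.rpow_one]

lemma hasDerivAt_lpProfile (hp : 2 ≤ p) {s : ℝ} (hs : s ∈ Ioo (0 : ℝ) 1) :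
    HasDerivAt (lpProfile p) (-(s ^ (p - 1) * (1 - s ^ p) ^ (1 / p - 1))) s := by
  have h1 : s ^ p < 1 := Real.rpow_lt_one hs.1.le hs.2 (by linarith)
  have h2 := ((hasDerivAt_const s (1 : ℝ)).sub
    (Real.hasDerivAt_rpow_const (x := s) (p := p) (Or.inl hs.1.ne'))).rpow_const (p := 1 / p)
      (Or.inl (by simp only [Pi.sub_apply]; linarith))
  have h3 : HasDerivAt (lpProfile p) _ s := h2.congr_of_eventuallyEq (by
    filter_upwards [lt_mem_nhds hs.1] with t ht using lpProfile_of_nonneg ht.le)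
  refine h3.congr_deriv ?_
  simp only [Pi.sub_apply]
  field_simp
  ring

lemma contDiffAt_lpProfile (hp : 2 ≤ p) {s : ℝ} (hs : s ∈ Ioo (-1 : ℝ) 1) (h0 : s ≠ 0) :
    ContDiffAt ℝ ∞ (lpProfile p) s := by
  have h1 : ContDiffAt ℝ ∞ (fun s : ℝ => |s| ^ p) s :=
    (contDiffAt_abs h0).rpow_const_of_ne (abs_ne_zero.2 h0)
  exact (contDiffAt_const.sub h1).rpow_const_of_ne (by linarith [abs_rpow_lt_one hp hs])

lemma continuous_lpSlice (hp : 2 ≤ p) : Continuous (lpSlice p) :=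
  intervalIntegral.continuous_primitive
    (fun _ _ => (continuous_lpProfile hp).intervalIntegrable _ _) 0

lemma continuous_lpSector (hp : 2 ≤ p) : Continuous (lpSector p) :=
  (continuous_lpSlice hp).sub ((continuous_id.mul (continuous_lpProfile hp)).div_const 2)

lemma hasDerivAt_lpSlice (hp : 2 ≤ p) (x : ℝ) : HasDerivAt (lpSlice p) (lpProfile p x) x :=
  intervalIntegral.integral_hasDerivAt_right ((continuous_lpProfile hp).intervalIntegrable _ _)
    (continuous_lpProfile hp).aestronglyMeasurable.stronglyMeasurableAtFilter
    (continuous_lpProfile hp).continuousAt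

lemma lpProfile_eq_mul (hp : 2 ≤ p) {s : ℝ} (hs : s ∈ Ioo (0 : ℝ) 1) :
    lpProfile p s = (1 - s ^ p) ^ (1 / p - 1) * (1 - s ^ p) := by
  have h1 : s ^ p < 1 := Real.rpow_lt_one hs.1.le hs.2 (by linarith)
  rw [lpProfile_of_nonneg hs.1.le, Real.rpow_sub_one (by linarith : 1 - s ^ p ≠ 0),
    div_mul_cancel₀ _ (by linarith)]

lemma mul_rpow_sub_one {s : ℝ} (hs : 0 < s) : s * s ^ (p - 1) = s ^ p := by
  rw [Real.rpow_sub_one hs.ne']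
  field_simp

lemma hasDerivAt_mul_lpProfile (hp : 2 ≤ p) {s : ℝ} (hs : s ∈ Ioo (0 : ℝ) 1) :
    HasDerivAt (fun x => x * lpProfile p x)
      ((1 - s ^ p) ^ (1 / p - 1) * (1 - 2 * s ^ p)) s := by
  refine ((hasDerivAt_id s).mul (hasDerivAt_lpProfile hp hs)).congr_deriv ?_
  have := mul_rpow_sub_one (p := p) hs.1
  simp only [id]
  rw [mul_neg, ← mul_assoc, this, lpProfile_eq_mul hp hs]
  ring

/-- The derivative is `(b - x * b') / 2` with `b = lpProfile p`. The factor `(1 - s ^ p) ^ (1 / p -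
1)` splits off, leaving `(1 - s ^ p) + s ^ p = 1`. -/
lemma hasDerivAt_lpSector (hp : 2 ≤ p) {s : ℝ} (hs : s ∈ Ioo (0 : ℝ) 1) :
    HasDerivAt (lpSector p) ((1 - s ^ p) ^ (1 / p - 1) / 2) s := by
  refine ((hasDerivAt_lpSlice hp s).sub
    ((hasDerivAt_mul_lpProfile hp hs).div_const 2)).congr_deriv ?_
  rw [lpProfile_eq_mul hp hs]
  ring

lemma lpSector_zero : lpSector p 0 = 0 := by simp [lpSector, lpSlice]

lemma lpSector_one (hp : 2 ≤ p) : lpSector p 1 = lpSlice p 1 := by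
  simp [lpSector, lpProfile_one hp]

lemma strictMonoOn_lpSector (hp : 2 ≤ p) : StrictMonoOn (lpSector p) (Icc 0 1) := by
  refine strictMonoOn_of_deriv_pos (convex_Icc _ _) (continuous_lpSector hp).continuousOn ?_
  intro x hx
  rw [interior_Icc] at hx
  rw [(hasDerivAt_lpSector hp hx).deriv]
  have h1 : x ^ p < 1 := Real.rpow_lt_one hx.1.le hx.2 (by linarith)
  have := Real.rpow_pos_of_pos (by linarith : 0 < 1 - x ^ p) (1 / p - 1)
  positivity

lemma lpSlice_one_pos (hp : 2 ≤ p) : 0 < lpSlice p 1 := by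
  rw [← lpSector_one hp, ← lpSector_zero (p := p)]
  exact strictMonoOn_lpSector hp ⟨le_rfl, zero_le_one⟩ ⟨zero_le_one, le_rfl⟩ one_pos

/-- The reflection in the diagonal exchanges complementary sectors. -/
lemma lpSector_lpProfile (hp : 2 ≤ p) {x : ℝ} (hx : x ∈ Icc (0 : ℝ) 1) :
    lpSector p (lpProfile p x) = lpSlice p 1 - lpSector p x := by
  have hd : ∀ s ∈ Ioo (0 : ℝ) 1,
      HasDerivAt (fun x => lpSector p (lpProfile p x) + lpSector p x) 0 s := by
    intro s hs
    have h1 : s ^ p < 1 := Real.rpow_lt_one hs.1.le hs.2 (by linarith)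
    have h0 : 0 < s ^ p := Real.rpow_pos_of_pos hs.1 p
    have hsI : s ∈ Icc (0 : ℝ) 1 := Ioo_subset_Icc_self hs
    have hbI : lpProfile p s ∈ Ioo (0 : ℝ) 1 := by
      refine ⟨lpProfile_pos hp ⟨by linarith [hs.1], hs.2⟩, ?_⟩
      rw [lpProfile_of_nonneg hs.1.le]
      have : 0 < 1 / p := by positivity
      exact Real.rpow_lt_one (by linarith) (by linarith) this
    have h2 := ((hasDerivAt_lpSector hp hbI).comp s (hasDerivAt_lpProfile hp hs)).add
      (hasDerivAt_lpSector hp hs)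
    refine h2.congr_deriv ?_
    rw [lpProfile_rpow hp hsI, sub_sub_cancel]
    -- With `e1` the derivatives of the two sector areas cancel, so their sum keeps its value at
    -- zero.
    have e1 : (s ^ p) ^ (1 / p - 1) * s ^ (p - 1) = 1 := by
      rw [← Real.rpow_mul hs.1.le, ← Real.rpow_add hs.1]
      have : p * (1 / p - 1) + (p - 1) = 0 := by field_simp; ring
      rw [this, Real.rpow_zero]
    linear_combination (-(1 - s ^ p) ^ (1 / p - 1) / 2) * e1
  have hc : ContinuousOn (fun x => lpSector p (lpProfile p x) + lpSector p x) (Icc 0 1) :=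
    (((continuous_lpSector hp).comp (continuous_lpProfile hp)).add
      (continuous_lpSector hp)).continuousOn
  have hle : ∀ x ∈ Icc (0 : ℝ) 1, lpSector p (lpProfile p x) + lpSector p x = lpSlice p 1 := by
    intro x hx
    rcases hx.1.eq_or_lt with h | h
    · rw [← h, lpProfile_zero hp, lpSector_one hp, lpSector_zero, add_zero]
    obtain ⟨c, hc1, hc2⟩ := exists_hasDerivAt_eq_slope
      (fun x => lpSector p (lpProfile p x) + lpSector p x) (fun _ => 0) h
      (hc.mono (Icc_subset_Icc le_rfl hx.2)) fun y hy => hd y ⟨hy.1, hy.2.trans_le hx.2⟩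
    rw [eq_comm, div_eq_zero_iff, lpProfile_zero hp, lpSector_one hp, lpSector_zero] at hc2
    rcases hc2 with h2 | h2 <;> linarith
  linarith [hle x hx]

/-- The point of the diagonal on the boundary of the unit `ℓᵖ`-ball. -/
noncomputable def lpDiag (p : ℝ) : ℝ := (1 / 2 : ℝ) ^ (1 / p)

lemma lpDiag_rpow (hp : 2 ≤ p) : lpDiag p ^ p = 1 / 2 := by
  rw [lpDiag, ← Real.rpow_mul (by norm_num), one_div_mul_cancel (by linarith), Real.rpow_one]

lemma lpDiag_mem (hp : 2 ≤ p) : lpDiag p ∈ Ioo (0 : ℝ) 1 := by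
  have : 0 < 1 / p := by positivity
  exact ⟨Real.rpow_pos_of_pos (by norm_num) _,
    Real.rpow_lt_one (by norm_num) (by norm_num) this⟩

lemma lpProfile_lpDiag (hp : 2 ≤ p) : lpProfile p (lpDiag p) = lpDiag p := by
  rw [lpProfile_of_nonneg (lpDiag_mem hp).1.le, lpDiag_rpow hp, lpDiag]
  norm_num

lemma lpSector_lpDiag (hp : 2 ≤ p) : lpSector p (lpDiag p) = lpSlice p 1 / 2 := by
  have := lpSector_lpProfile hp (Ioo_subset_Icc_self (lpDiag_mem hp))
  rw [lpProfile_lpDiag hp] at this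
  linarith

lemma rpow_le_half (hp : 2 ≤ p) {x : ℝ} (h0 : 0 ≤ x) (hx : x ≤ lpDiag p) : x ^ p ≤ 1 / 2 := by
  rw [← lpDiag_rpow hp]
  exact Real.rpow_le_rpow h0 hx (by linarith)

/-! ### Comparison of angles, sectors and inscribed rectangles -/

/-- The angle `w` with `sin² w = xᵖ`. -/
noncomputable def lpAngle (p x : ℝ) : ℝ := Real.arcsin (x ^ (p / 2))

lemma rpow_half_sq {x : ℝ} (hx : 0 ≤ x) : (x ^ (p / 2)) ^ 2 = x ^ p := by
  rw [← Real.rpow_natCast, ← Real.rpow_mul hx]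
  norm_num

lemma continuous_lpAngle (hp : 2 ≤ p) : Continuous (lpAngle p) :=
  Real.continuous_arcsin.comp (Real.continuous_rpow_const (by linarith))

/-- The derivative is factored as that of `lpSector p` times the derivative of the angle with
respect to sector area, `p * (s ^ p * (1 - s ^ p)) ^ (1 / 2 - 1 / p)`. -/
lemma hasDerivAt_lpAngle (hp : 2 ≤ p) {s : ℝ} (hs : s ∈ Ioo (0 : ℝ) 1) :
    HasDerivAt (lpAngle p) ((1 - s ^ p) ^ (1 / p - 1) / 2 *
      (p * (s ^ p * (1 - s ^ p)) ^ (1 / 2 - 1 / p))) s := by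
  have h1 : s ^ p < 1 := Real.rpow_lt_one hs.1.le hs.2 (by linarith)
  have h1' : s ^ (p / 2) < 1 := Real.rpow_lt_one hs.1.le hs.2 (by linarith)
  have h0' : 0 < s ^ (p / 2) := Real.rpow_pos_of_pos hs.1 _
  have h2 := (Real.hasDerivAt_arcsin (by linarith : s ^ (p / 2) ≠ -1) h1'.ne).comp s
    (Real.hasDerivAt_rpow_const (x := s) (p := p / 2) (Or.inl hs.1.ne'))
  refine h2.congr_deriv ?_
  have hT : 0 < 1 - s ^ p := by linarith
  have hp0 : p ≠ 0 := by linarith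
  rw [rpow_half_sq hs.1.le, Real.sqrt_eq_rpow, one_div, ← Real.rpow_neg hT.le,
    Real.mul_rpow (Real.rpow_nonneg hs.1.le p) hT.le, ← Real.rpow_mul hs.1.le]
  have e1 : p * (1 / 2 - 1 / p) = p / 2 - 1 := by field_simp
  have e2 : (1 - s ^ p) ^ (-(1 / 2 : ℝ)) =
      (1 - s ^ p) ^ (1 / p - 1) * (1 - s ^ p) ^ (1 / 2 - 1 / p) := by
    rw [← Real.rpow_add hT]
    ring_nf
  rw [e1, e2]
  ring

lemma lpAngle_zero (hp : 2 ≤ p) : lpAngle p 0 = 0 := by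
  simp [lpAngle, Real.zero_rpow (by linarith : p / 2 ≠ 0)]

lemma lpAngle_lpDiag (hp : 2 ≤ p) : lpAngle p (lpDiag p) = Real.pi / 4 := by
  have hd := (lpDiag_mem hp).1.le
  have h := rpow_half_sq (p := p) hd
  rw [lpDiag_rpow hp] at h
  rw [lpAngle, ← Real.arcsin_sin (x := Real.pi / 4) (by linarith [Real.pi_pos])
    (by linarith [Real.pi_pos]), Real.sin_pi_div_four]
  congr 1
  have h2 : (√2 / 2) ^ 2 = (1 / 2 : ℝ) := by
    rw [div_pow, Real.sq_sqrt (by norm_num)]; norm_num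
  exact (pow_left_inj₀ (Real.rpow_nonneg hd _) (by positivity) two_ne_zero).1 (h.trans h2.symm)

/-- As a function of the sector area the angle is convex up to the diagonal, hence below its
chord. -/
lemma lpAngle_le (hp : 2 ≤ p) {x : ℝ} (h0 : 0 ≤ x) (hx : x ≤ lpDiag p) :
    lpAngle p x * (lpSlice p 1 / 2) ≤ Real.pi / 4 * lpSector p x := by
  rcases h0.eq_or_lt with rfl | h0
  · simp [lpAngle_zero hp, lpSector_zero]
  rcases hx.eq_or_lt with rfl | hx
  · rw [lpAngle_lpDiag hp, lpSector_lpDiag hp]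
  have hd := lpDiag_mem hp
  have hx1 : x < 1 := hx.trans hd.2
  -- Cauchy's mean value theorem, here on `[0, x]` and next on `[x, lpDiag p]`, expresses the chord
  -- slopes of angle against sector area as `q c` and `q d` with `c < x < d`.
  obtain ⟨c, hc, hc'⟩ := exists_ratio_hasDerivAt_eq_ratio_slope (lpAngle p) _ h0
    (continuous_lpAngle hp).continuousOn
    (fun s hs => hasDerivAt_lpAngle hp ⟨hs.1, hs.2.trans hx1⟩) (lpSector p) _
    (continuous_lpSector hp).continuousOn
    (fun s hs => hasDerivAt_lpSector hp ⟨hs.1, hs.2.trans hx1⟩)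
  obtain ⟨d, hd1, hd'⟩ := exists_ratio_hasDerivAt_eq_ratio_slope (lpAngle p) _ hx
    (continuous_lpAngle hp).continuousOn
    (fun s hs => hasDerivAt_lpAngle hp ⟨h0.trans hs.1, hs.2.trans hd.2⟩) (lpSector p) _
    (continuous_lpSector hp).continuousOn
    (fun s hs => hasDerivAt_lpSector hp ⟨h0.trans hs.1, hs.2.trans hd.2⟩)
  have cpos : 0 < (1 - c ^ p) ^ (1 / p - 1) / 2 := by
    have : c ^ p < 1 := Real.rpow_lt_one hc.1.le (hc.2.trans hx1) (by linarith)
    have := Real.rpow_pos_of_pos (by linarith : 0 < 1 - c ^ p) (1 / p - 1)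
    positivity
  have dpos : 0 < (1 - d ^ p) ^ (1 / p - 1) / 2 := by
    have : d ^ p < 1 := Real.rpow_lt_one (h0.trans hd1.1).le (hd1.2.trans hd.2) (by linarith)
    have := Real.rpow_pos_of_pos (by linarith : 0 < 1 - d ^ p) (1 / p - 1)
    positivity
  rw [lpAngle_zero hp, lpSector_zero, sub_zero, sub_zero] at hc'
  rw [lpAngle_lpDiag hp, lpSector_lpDiag hp] at hd'
  set q : ℝ → ℝ := fun s => p * (s ^ p * (1 - s ^ p)) ^ (1 / 2 - 1 / p) with hq
  have h1 : lpAngle p x = lpSector p x * q c := by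
    refine mul_right_cancel₀ cpos.ne' ?_
    linear_combination -hc'
  have h2 : Real.pi / 4 - lpAngle p x = (lpSlice p 1 / 2 - lpSector p x) * q d := by
    refine mul_right_cancel₀ dpos.ne' ?_
    linear_combination -hd'
  -- For `p ≥ 2` the exponent `1 / 2 - 1 / p` is nonnegative, and `t * (1 - t)` increases up to `t =
  -- 1 / 2`, the value of `s ^ p` on the diagonal.
  have hqcd : q c ≤ q d := by
    have hcd : c ≤ d := (hc.2.trans hd1.1).le
    have g1 : c ^ p ≤ d ^ p := Real.rpow_le_rpow hc.1.le hcd (by linarith)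
    have g2 : d ^ p ≤ 1 / 2 := rpow_le_half hp (hc.1.le.trans hcd) hd1.2.le
    have g3 : 0 ≤ c ^ p := Real.rpow_nonneg hc.1.le p
    refine mul_le_mul_of_nonneg_left (Real.rpow_le_rpow (mul_nonneg g3 (by linarith))
      (by nlinarith) ?_) (by linarith)
    rw [sub_nonneg]
    exact one_div_le_one_div_of_le (by norm_num) hp
  have hs0 : 0 ≤ lpSector p x := by
    rw [← lpSector_zero (p := p)]
    exact (strictMonoOn_lpSector hp).monotoneOn ⟨le_rfl, zero_le_one⟩ ⟨h0.le, hx1.le⟩ h0.le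
  have hs1 : lpSector p x ≤ lpSlice p 1 / 2 := by
    rw [← lpSector_lpDiag hp]
    exact (strictMonoOn_lpSector hp).monotoneOn ⟨h0.le, hx1.le⟩ (Ioo_subset_Icc_self hd) hx.le
  have h3 : lpAngle p x * (lpSlice p 1 / 2 - lpSector p x) ≤
      (Real.pi / 4 - lpAngle p x) * lpSector p x := by
    rw [h2, h1]
    have := mul_le_mul_of_nonneg_left hqcd (mul_nonneg hs0 (sub_nonneg.2 hs1))
    linarith
  linarith

/-- Among sectors of equal area, that of the `ℓᵖ`-ball spans at least as large a rectangle as that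
of the disc of equal total area. -/
lemma sin_le_mul_lpProfile (hp : 2 ≤ p) {x : ℝ} (hx : x ∈ Icc (0 : ℝ) 1) :
    2 * lpSlice p 1 / Real.pi * Real.sin (Real.pi * lpSector p x / lpSlice p 1) ≤
      x * lpProfile p x := by
  have hK := lpSlice_one_pos hp
  have hπ := Real.pi_pos
  have hd := lpDiag_mem hp
  have first : ∀ x, 0 ≤ x → x ≤ lpDiag p →
      2 * lpSlice p 1 / Real.pi * Real.sin (Real.pi * lpSector p x / lpSlice p 1) ≤
        x * lpProfile p x := by
    intro x h0 hxd
    -- The difference vanishes at zero. Since `1 - 2 * s ^ p = cos (2 * lpAngle p s)`, its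
    -- derivative is nonnegative exactly by the angle bound `lpAngle_le`.
    have hmono : MonotoneOn (fun x => x * lpProfile p x -
        2 * lpSlice p 1 / Real.pi * Real.sin (Real.pi * lpSector p x / lpSlice p 1))
        (Icc 0 (lpDiag p)) := by
      have hder : ∀ s ∈ Ioo 0 (lpDiag p), HasDerivAt (fun x => x * lpProfile p x -
          2 * lpSlice p 1 / Real.pi * Real.sin (Real.pi * lpSector p x / lpSlice p 1))
          ((1 - s ^ p) ^ (1 / p - 1) *
            (1 - 2 * s ^ p - Real.cos (Real.pi * lpSector p s / lpSlice p 1))) s := by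
        intro s hs
        have hs' : s ∈ Ioo (0 : ℝ) 1 := ⟨hs.1, hs.2.trans hd.2⟩
        refine ((hasDerivAt_mul_lpProfile hp hs').sub
          ((((hasDerivAt_lpSector hp hs').const_mul Real.pi).div_const
            (lpSlice p 1)).sin.const_mul (2 * lpSlice p 1 / Real.pi))).congr_deriv ?_
        field_simp
      refine monotoneOn_of_deriv_nonneg (convex_Icc _ _) ?_ ?_ ?_
      · refine Continuous.continuousOn ?_
        exact (continuous_id.mul (continuous_lpProfile hp)).sub (continuous_const.mul
          (Real.continuous_sin.comp ((continuous_const.mul (continuous_lpSector hp)).div_const _)))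
      · rw [interior_Icc]
        exact fun s hs => (hder s hs).differentiableAt.differentiableWithinAt
      · rw [interior_Icc]
        intro s hs
        rw [(hder s hs).deriv]
        have hs' : s ∈ Ioo (0 : ℝ) 1 := ⟨hs.1, hs.2.trans hd.2⟩
        have h1 : s ^ p < 1 := Real.rpow_lt_one hs'.1.le hs'.2 (by linarith)
        refine mul_nonneg (Real.rpow_nonneg (by linarith) _) ?_
        have hw := lpAngle_le hp hs.1.le hs.2.le
        have hcos : Real.cos (2 * lpAngle p s) = 1 - 2 * s ^ p := by
          have h0' : 0 ≤ s ^ (p / 2) := Real.rpow_nonneg hs'.1.le _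
          have h1' : s ^ (p / 2) ≤ 1 := Real.rpow_le_one hs'.1.le hs'.2.le (by linarith)
          rw [Real.cos_two_mul, Real.cos_sq', lpAngle, Real.sin_arcsin (by linarith) h1',
            rpow_half_sq hs'.1.le]
          ring
        have hs1 : lpSector p s ≤ lpSlice p 1 / 2 := by
          rw [← lpSector_lpDiag hp]
          exact (strictMonoOn_lpSector hp).monotoneOn (Ioo_subset_Icc_self hs')
            (Ioo_subset_Icc_self hd) hs.2.le
        have hw0 : 0 ≤ lpAngle p s := Real.arcsin_nonneg.2 (Real.rpow_nonneg hs'.1.le _)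
        rw [sub_nonneg, ← hcos]
        refine Real.cos_le_cos_of_nonneg_of_le_pi (by linarith) ?_ ?_
        · rw [div_le_iff₀ hK]
          nlinarith
        · rw [le_div_iff₀ hK]
          linarith
    have h := hmono ⟨le_rfl, hd.1.le⟩ ⟨h0, hxd⟩ h0
    simp only [lpSector_zero, mul_zero, zero_div, Real.sin_zero, zero_mul, sub_zero] at h
    linarith
  rcases le_total x (lpDiag p) with h | h
  · exact first x hx.1 h
  · have hb := lpProfile_mem hp hx
    have hbd : lpProfile p x ≤ lpDiag p := by
      have h1 : lpDiag p ^ p ≤ x ^ p := Real.rpow_le_rpow hd.1.le h (by linarith)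
      refine (Real.rpow_le_rpow_iff hb.1 hd.1.le (by linarith : 0 < p)).1 ?_
      rw [lpProfile_rpow hp hx]
      rw [lpDiag_rpow hp] at h1 ⊢
      linarith
    -- Beyond the diagonal, reflection preserves the rectangle and replaces the argument of the sine
    -- by its supplement.
    have h2 := first _ hb.1 hbd
    rw [lpSector_lpProfile hp hx, lpProfile_lpProfile hp hx] at h2
    have e : Real.pi * (lpSlice p 1 - lpSector p x) / lpSlice p 1 =
        Real.pi - Real.pi * lpSector p x / lpSlice p 1 := by
      field_simp
    rw [e, Real.sin_pi_sub] at h2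
    linarith

/-- Substitute `s = ρ * sin t`. The two summands are a circular sector of angle `θ` and half of the
inscribed rectangle. -/
lemma integral_sqrt_sq_sub_sq {ρ θ : ℝ} (hρ : 0 ≤ ρ) (h0 : 0 ≤ θ) (h1 : θ ≤ Real.pi / 2) :
    ∫ s in (0 : ℝ)..ρ * Real.sin θ, √(ρ ^ 2 - s ^ 2) =
      ρ ^ 2 / 2 * (θ + Real.sin (2 * θ) / 2) := by
  have h := intervalIntegral.integral_comp_mul_deriv (a := 0) (b := θ)
    (f := fun t => ρ * Real.sin t) (f' := fun t => ρ * Real.cos t)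
    (g := fun s => √(ρ ^ 2 - s ^ 2)) (fun t _ => (Real.hasDerivAt_sin t).const_mul ρ)
    (by fun_prop) (by fun_prop)
  simp only [Real.sin_zero, mul_zero] at h
  rw [← h]
  have e : ∫ t in (0 : ℝ)..θ, ((fun s => √(ρ ^ 2 - s ^ 2)) ∘ fun t => ρ * Real.sin t) t *
      (ρ * Real.cos t) = ∫ t in (0 : ℝ)..θ, ρ ^ 2 * Real.cos t ^ 2 := by
    refine intervalIntegral.integral_congr fun t ht => ?_
    rw [uIcc_of_le h0] at ht
    have hc : 0 ≤ Real.cos t := Real.cos_nonneg_of_mem_Icc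
      ⟨by linarith [ht.1, Real.pi_pos], by linarith [ht.2]⟩
    have : ρ ^ 2 - (ρ * Real.sin t) ^ 2 = (ρ * Real.cos t) ^ 2 := by
      linear_combination ρ ^ 2 * (-(Real.sin_sq_add_cos_sq t))
    simp only [Function.comp, this, Real.sqrt_sq (mul_nonneg hρ hc)]
    ring
  rw [e, intervalIntegral.integral_const_mul, integral_cos_sq, Real.sin_two_mul]
  simp
  ring

/-- Comparison of rectangles inscribed in the `ℓᵖ`-ball and in the disc of `μ` times its area, when
the areas to the left of their sides agree up to a factor `μ`. -/
lemma mul_le_mul_lpProfile (hp : 2 ≤ p) {x τ r μ : ℝ} (hx : x ∈ Icc (0 : ℝ) 1) (hτ : 0 < τ)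
    (hμ : 0 < μ) (hτK : Real.pi * τ ^ 2 = μ * (4 * lpSlice p 1)) (hr0 : 0 ≤ r) (hr : r ≤ τ)
    (hlow : ∫ s in (0 : ℝ)..r, √(τ ^ 2 - s ^ 2) ≤ lpSlice p x)
    (hup : μ * lpSlice p x ≤ ∫ s in (0 : ℝ)..r, √(τ ^ 2 - s ^ 2)) :
    r * √(τ ^ 2 - r ^ 2) ≤ x * lpProfile p x := by
  have hK := lpSlice_one_pos hp
  have hπ := Real.pi_pos
  obtain ⟨θ, hθ0, hθ1, hθ⟩ : ∃ θ, 0 ≤ θ ∧ θ ≤ Real.pi / 2 ∧ r = τ * Real.sin θ := by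
    have h1 : 0 ≤ r / τ := div_nonneg hr0 hτ.le
    refine ⟨Real.arcsin (r / τ), Real.arcsin_nonneg.2 h1, Real.arcsin_le_pi_div_two _, ?_⟩
    rw [Real.sin_arcsin (by linarith) ((div_le_one hτ).2 hr)]
    field_simp
  have hc : 0 ≤ Real.cos θ := Real.cos_nonneg_of_mem_Icc ⟨by linarith, hθ1⟩
  have hrect : r * √(τ ^ 2 - r ^ 2) = τ ^ 2 / 2 * Real.sin (2 * θ) := by
    have : τ ^ 2 - r ^ 2 = (τ * Real.cos θ) ^ 2 := by
      rw [hθ]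
      linear_combination τ ^ 2 * (-(Real.sin_sq_add_cos_sq θ))
    rw [this, Real.sqrt_sq (mul_nonneg hτ.le hc), hθ, Real.sin_two_mul]
    ring
  rw [hθ, integral_sqrt_sq_sub_sq hτ.le hθ0 hθ1] at hlow hup
  -- `κ` is the squared radius of the disc with the area of the `ℓᵖ`-ball.
  obtain ⟨κ, hκ⟩ : ∃ κ, κ = 4 * lpSlice p 1 / Real.pi := ⟨_, rfl⟩
  have hκ0 : 0 < κ := by rw [hκ]; positivity
  have hκK : Real.pi * κ = 4 * lpSlice p 1 := by rw [hκ]; field_simp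
  have hτκ : τ ^ 2 = μ * κ := by
    rw [hκ]
    field_simp
    linarith
  have hup' : lpSlice p x ≤ κ / 2 * (θ + Real.sin (2 * θ) / 2) := by
    refine le_of_mul_le_mul_left ?_ hμ
    rw [hτκ] at hup
    linarith
  rw [hτκ] at hlow
  rw [hrect, hτκ]
  set σ := lpSector p x with hσ
  set R := x * lpProfile p x with hR
  have hB : lpSlice p x = σ + R / 2 := by rw [hσ, lpSector]; ring
  rw [hB] at hlow hup'
  -- `u` is the angle of the sector of area `σ` in the disc of squared radius `κ`.
  set u := 2 * σ / κ with hu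
  have hσu : σ = κ / 2 * u := by rw [hu]; field_simp
  have hmain : κ / 2 * Real.sin (2 * u) ≤ R := by
    have h := sin_le_mul_lpProfile hp hx
    have e1 : 2 * lpSlice p 1 / Real.pi = κ / 2 := by
      field_simp
      linarith
    have e2 : Real.pi * lpSector p x / lpSlice p 1 = 2 * u := by
      rw [hu, ← hσ]
      field_simp
      linear_combination σ * hκK
    rwa [e1, e2] at h
  have hσ0 : 0 ≤ σ := by
    rw [hσ, ← lpSector_zero (p := p)]
    exact (strictMonoOn_lpSector hp).monotoneOn ⟨le_rfl, zero_le_one⟩ hx hx.1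
  have hκ2 : 0 < κ / 2 := by positivity
  have hu0 : 0 ≤ u := by rw [hu]; positivity
  -- If the `ℓᵖ`-rectangle were too small, `hlow` would force a large sector, `μ * θ < u`. On the
  -- other side `hup` gives `u ≤ θ`, because `t + sin (2 * t) / 2` increases. Concavity of sine on
  -- `[0, π]` then yields `μ * sin (2 * θ) ≤ sin (2 * u)`, contradicting `hcon` through `hmain`.
  by_contra! hcon
  have hu1 : μ * θ < u := by
    have : κ / 2 * (μ * θ) < κ / 2 * u := by
      rw [← hσu]; linarith
    exact lt_of_mul_lt_mul_left this hκ2.le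
  have hu2 : u ≤ θ := by
    by_contra! hlt
    have h1 : κ / 2 * (u + Real.sin (2 * u) / 2) ≤
        κ / 2 * (θ + Real.sin (2 * θ) / 2) := by
      rw [hσu] at hup'
      linarith
    have h2 := le_of_mul_le_mul_left h1 hκ2
    have h3 : Real.sin (2 * θ) - Real.sin (2 * u) < 2 * (u - θ) := by
      have hs := Real.sin_sub_sin (2 * θ) (2 * u)
      have e : (2 * θ - 2 * u) / 2 = -(u - θ) := by ring
      rw [e, Real.sin_neg] at hs
      have h4 := Real.sin_lt (by linarith : 0 < u - θ)
      have h5 := Real.neg_one_le_cos ((2 * θ + 2 * u) / 2)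
      have h6 := Real.cos_le_one ((2 * θ + 2 * u) / 2)
      have h7 : |Real.sin (u - θ)| < u - θ := abs_lt.2 ⟨by
        rcases le_or_gt (u - θ) 1 with h | h
        · linarith [Real.sin_pos_of_pos_of_le_one (by linarith : 0 < u - θ) h]
        · linarith [Real.neg_one_le_sin (u - θ)], h4⟩
      have h8 : |Real.sin (u - θ) * Real.cos ((2 * θ + 2 * u) / 2)| ≤ |Real.sin (u - θ)| := by
        rw [abs_mul]
        exact mul_le_of_le_one_right (abs_nonneg _) (abs_le.2 ⟨h5, h6⟩)
      have h9 := neg_abs_le (Real.sin (u - θ) * Real.cos ((2 * θ + 2 * u) / 2))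
      rw [hs]
      linarith
    linarith
  have hθpos : 0 < θ := lt_of_le_of_ne hθ0 fun h => by
    rw [← h] at hu1 hu2
    linarith
  have hconc : u / θ * Real.sin (2 * θ) ≤ Real.sin (2 * u) := by
    have h1 : u / θ ≤ 1 := (div_le_one hθpos).2 hu2
    have hz : (0 : ℝ) ∈ Icc 0 Real.pi := ⟨le_rfl, hπ.le⟩
    have hθI : 2 * θ ∈ Icc 0 Real.pi := ⟨by linarith, by linarith⟩
    have h := strictConcaveOn_sin_Icc.concaveOn.2 hz hθI (sub_nonneg.2 h1)
      (div_nonneg hu0 hθ0) (by ring)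
    have e : u / θ * (2 * θ) = 2 * u := by field_simp
    simpa [e] using h
  have hs2 : 0 ≤ Real.sin (2 * θ) := Real.sin_nonneg_of_nonneg_of_le_pi (by linarith) (by linarith)
  have h4 : μ * Real.sin (2 * θ) ≤ Real.sin (2 * u) := by
    refine le_trans (mul_le_mul_of_nonneg_right ?_ hs2) hconc
    rw [le_div_iff₀ hθpos]
    exact hu1.le
  have h5 := mul_le_mul_of_nonneg_left h4 hκ2.le
  linarith

end Profile

/-! ### The area of the planar `ℓᵖ`-ball -/

section Area

open MeasureTheory

lemma abs_lt_lpProfile_iff {p : ℝ} (hp : 2 ≤ p) {s t : ℝ} (hs : s ∈ Ioo (-1 : ℝ) 1) :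
    |t| < lpProfile p s ↔ |s| ^ p + |t| ^ p < 1 := by
  have hs' : |s| ∈ Icc (0 : ℝ) 1 := ⟨abs_nonneg s, (abs_lt.2 hs).le⟩
  have h : lpProfile p s = lpProfile p |s| := by simp [lpProfile]
  rw [h, ← Real.rpow_lt_rpow_iff (abs_nonneg t) (lpProfile_mem hp hs').1
    (by linarith : 0 < p), lpProfile_rpow hp hs']
  constructor <;> intro h <;> linarith

lemma mem_Ioo_of_rpow_add_rpow_lt_one {p : ℝ} (hp : 2 ≤ p) {s t : ℝ}
    (h : |s| ^ p + |t| ^ p < 1) : s ∈ Ioo (-1 : ℝ) 1 := by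
  have h1 : |s| ^ p < 1 ^ p := by
    rw [Real.one_rpow]
    linarith [Real.rpow_nonneg (abs_nonneg t) p]
  exact abs_lt.1 ((Real.rpow_lt_rpow_iff (abs_nonneg s) zero_le_one (by linarith : 0 < p)).1 h1)

/-- The area of the planar unit `ℓᵖ`-ball. -/
lemma four_mul_lpSlice_one {p : ℝ} (hp : 2 ≤ p) :
    4 * lpSlice p 1 = 4 * Real.Gamma (1 + 1 / p) ^ 2 / Real.Gamma (1 + 2 / p) := by
  have hvol := MeasureTheory.volume_sum_rpow_lt_one (Fin 2) (by linarith : 1 ≤ p)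
  have hcont := continuous_lpProfile hp
  have hset : {x : Fin 2 → ℝ | ∑ i, |x i| ^ p < 1} = MeasurableEquiv.finTwoArrow ⁻¹'
      regionBetween (fun s => -lpProfile p s) (lpProfile p) (Ioo (-1) 1) := by
    ext x
    simp only [mem_ofPred_eq, Fin.sum_univ_two, mem_preimage, regionBetween,
      MeasurableEquiv.finTwoArrow_apply, mem_Ioo (a := -lpProfile p _), ← abs_lt]
    constructor
    · intro h
      have hs := mem_Ioo_of_rpow_add_rpow_lt_one hp h
      exact ⟨hs, (abs_lt_lpProfile_iff hp hs).2 h⟩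
    · rintro ⟨hs, h⟩
      exact (abs_lt_lpProfile_iff hp hs).1 h
  have hb : IntegrableOn (lpProfile p) (Ioo (-1) 1) :=
    (hcont.integrableOn_Icc (a := -1) (b := 1)).mono_set Ioo_subset_Icc_self
  have hnb : IntegrableOn (fun s => -lpProfile p s) (Ioo (-1) 1) := hb.neg
  have hmeas : MeasurableSet (regionBetween (fun s => -lpProfile p s) (lpProfile p)
      (Ioo (-1) 1)) :=
    measurableSet_regionBetween hcont.measurable.neg hcont.measurable measurableSet_Ioo
  rw [hset, (volume_preserving_finTwoArrow ℝ).measure_preimage hmeas.nullMeasurableSet,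
    Measure.volume_eq_prod, volume_regionBetween_eq_integral hnb hb measurableSet_Ioo
      (fun s hs => by linarith [lpProfile_pos hp hs])] at hvol
  have hint : ∫ s in Ioo (-1 : ℝ) 1, (lpProfile p - fun s => -lpProfile p s) s =
      4 * lpSlice p 1 := by
    rw [← integral_Ioc_eq_integral_Ioo, ← intervalIntegral.integral_of_le (by norm_num)]
    have h1 : ∀ s, (lpProfile p - fun s => -lpProfile p s) s = 2 * lpProfile p s := fun s => by
      simp only [Pi.sub_apply]; ring
    simp only [h1]
    rw [intervalIntegral.integral_const_mul,
      ← intervalIntegral.integral_add_adjacent_intervals (hcont.intervalIntegrable (-1) 0)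
        (hcont.intervalIntegrable 0 1)]
    have h2 : ∫ s in (-1 : ℝ)..0, lpProfile p s = lpSlice p 1 := by
      have := intervalIntegral.integral_comp_neg (a := 0) (b := 1) (lpProfile p)
      simp only [lpProfile_neg, neg_zero] at this
      exact this.symm
    rw [h2, lpSlice]
    ring
  have hp0 : 0 < p := by linarith
  rw [hint, Fintype.card_fin, ENNReal.ofReal_eq_ofReal_iff
    (by linarith [lpSlice_one_pos hp])] at hvol
  · rw [hvol, add_comm (1 / p), mul_pow]
    norm_num
    ring_nf
  · have := Real.Gamma_pos_of_pos (by positivity : 0 < ((2 : ℕ) : ℝ) / p + 1)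
    positivity

end Area

/-! ### The two symplectic embeddings -/

section Embeddings

lemma integral_sqrt_eq_pi_mul {τ : ℝ} (hτ : 0 ≤ τ) :
    ∫ s in (0 : ℝ)..τ, √(τ ^ 2 - s ^ 2) = Real.pi * τ ^ 2 / 4 := by
  have h := integral_sqrt_sq_sub_sq hτ (by positivity : 0 ≤ Real.pi / 2) le_rfl
  rw [Real.sin_pi_div_two, mul_one] at h
  rw [h, mul_div_cancel₀ _ two_ne_zero, Real.sin_pi]
  ring

lemma sq_sub_sq_pos {τ s : ℝ} (hs : s ∈ Ioo (-τ) τ) : 0 < τ ^ 2 - s ^ 2 := by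
  nlinarith [hs.1, hs.2]

lemma contDiffOn_sqrt_sq_sub_sq (τ : ℝ) :
    ContDiffOn ℝ ∞ (fun s => √(τ ^ 2 - s ^ 2)) (Ioo (-τ) τ) :=
  (contDiffOn_const.sub (contDiffOn_id.pow 2)).sqrt fun _ hs => (sq_sub_sq_pos hs).ne'

/-- A map acting on the first coordinate only, lifted to phase space. -/
lemma symplecticallyEmbeds_of_first_coordinate {n : ℕ} [NeZero n]
    {U V : TopologicalSpace.Opens (PhaseSpace n)} {X : ℝ → ℝ} {l : ℝ}
    (hX : ContDiffOn ℝ ∞ X (Ioo (-l) l)) (hX' : ∀ r ∈ Ioo (-l) l, 0 < deriv X r)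
    (hU : ∀ z ∈ U, z.1 0 ∈ Ioo (-l) l)
    (hmaps : ∀ z ∈ U, ∀ w : PhaseSpace n, w.1 0 = X (z.1 0) →
      w.2 0 = (deriv X (z.1 0))⁻¹ * z.2 0 → w ∈ V) :
    SymplecticallyEmbeds U V := by
  let e : EuclideanSpace ℝ (Fin n) := EuclideanSpace.single 0 1
  let π₀ : EuclideanSpace ℝ (Fin n) →L[ℝ] ℝ := EuclideanSpace.proj 0
  let W : Set (EuclideanSpace ℝ (Fin n)) := π₀ ⁻¹' Ioo (-l) l
  have he : π₀ e = 1 := by simp [e, π₀]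
  have hin : ∀ u, inner ℝ e u = π₀ u := fun u => by
    simp [e, π₀, EuclideanSpace.inner_single_left]
  have hin' : ∀ u, inner ℝ u e = π₀ u := fun u => by rw [real_inner_comm, hin]
  have hdX : ∀ r ∈ Ioo (-l) l, HasDerivAt X (deriv X r) r := fun r hr =>
    ((hX.contDiffAt (isOpen_Ioo.mem_nhds hr)).differentiableAt (by simp)).hasDerivAt
  have hmono : StrictMonoOn X (Ioo (-l) l) :=
    strictMonoOn_of_deriv_pos (convex_Ioo _ _) hX.continuousOn (by simpa using hX')
  have hπ : ContDiffOn ℝ ∞ π₀ W := π₀.contDiff.contDiffOn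
  have hsnd : ContDiffOn ℝ ∞ (fun x => deriv X (π₀ x)) W :=
    ((contDiffOn_infty_iff_deriv_of_isOpen isOpen_Ioo).1 hX).2.comp hπ fun _ hx => hx
  refine symplecticallyEmbeds_of_cotangentLift (W := W)
    (Φ := fun x => x + (X (π₀ x) - π₀ x) • e)
    (M := fun x => ContinuousLinearMap.id ℝ _ + ((deriv X (π₀ x))⁻¹ - 1) • π₀.smulRight e)
    (isOpen_Ioo.preimage π₀.continuous) ?_ ?_ ?_ ?_ hU ?_
  · exact contDiffOn_id.add (((hX.comp hπ fun _ hx => hx).sub hπ).smul contDiffOn_const)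
  · exact contDiffOn_const.add
      (((hsnd.inv fun x hx => (hX' _ hx).ne').sub contDiffOn_const).smul contDiffOn_const)
  · intro x hx y hy h
    have h1 := congrArg π₀ h
    simp only [map_add, map_smul, he, smul_eq_mul, mul_one, add_sub_cancel] at h1
    have h2 := hmono.injOn hx hy h1
    simpa [h2] using h
  · intro x hx u y
    have hf : HasFDerivAt (fun x => x + (X (π₀ x) - π₀ x) • e)
        (ContinuousLinearMap.id ℝ _ + (deriv X (π₀ x) • π₀ - π₀).smulRight e) x :=
      (hasFDerivAt_id x).add ((((hdX _ hx).comp_hasFDerivAt x π₀.hasFDerivAt).sub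
        π₀.hasFDerivAt).smul_const e)
    rw [hf.fderiv]
    have := (hX' _ hx).ne'
    simp [inner_add_left, inner_add_right, inner_smul_left, inner_smul_right, hin, hin', he]
    field_simp
    ring
  · intro z hz
    refine hmaps z hz _ ?_ ?_
    · simp [π₀, e]
    · simp [π₀, e]
      ring

/-- Projection to the first conjugate plane lands in the `ℓᵖ`-ball, so a planar slice-preserving
area transport into a larger disc suffices. -/
theorem lagrangianPSum_embeds_cylinder {n : ℕ} [NeZero n] {p : ℝ} (hp : 2 ≤ p) {R : ℝ}
    (hR : 4 * lpSlice p 1 < R) :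
    SymplecticallyEmbeds (lagrangianPSum n p (lt_of_lt_of_le two_pos hp)) (cylinder n R) := by
  have hK := lpSlice_one_pos hp
  have hR0 : 0 < R := by linarith
  have hπ := Real.pi_pos
  obtain ⟨τ, hτ0, hτ⟩ : ∃ τ, 0 < τ ∧ Real.pi * τ ^ 2 = R := by
    refine ⟨√(R / Real.pi), Real.sqrt_pos.2 (by positivity), ?_⟩
    rw [Real.sq_sqrt (by positivity)]
    field_simp
  -- The enlarged profile `η⁻¹ * g` dominates `lpProfile p`, and its area still fits in the disc
  -- because `4 * lpSlice p 1 < η * R`.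
  obtain ⟨η, hη1, hη2⟩ := exists_between ((div_lt_one hR0).2 hR)
  have hη0 : 0 < η := lt_of_le_of_lt (by positivity) hη1
  rw [div_lt_iff₀ hR0] at hη1
  obtain ⟨g, hg, -, hgpos, hgb⟩ := exists_flattening one_pos hη0 hη2
    (continuous_lpProfile hp).continuousAt (fun s hs => lpProfile_pos hp hs)
    (fun s hs h0 => contDiffAt_lpProfile hp hs h0)
  obtain ⟨X, hX, -, hXs⟩ := exists_smooth_transport_of_le (α := fun s => η⁻¹ * g s)
    (β := fun s => √(τ ^ 2 - s ^ 2)) (b := fun s => √(τ ^ 2 - s ^ 2)) (C := η⁻¹) (η := 1)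
    one_pos hτ0 (by positivity) (continuous_lpProfile hp) (by fun_prop) lpProfile_neg
    (by simp) (fun s hs => (lpProfile_pos hp hs).le) (contDiffOn_const.mul hg)
    (fun s hs => mul_pos (inv_pos.2 hη0) (hgpos s hs)) (contDiffOn_sqrt_sq_sub_sq τ)
    (fun s hs => Real.sqrt_pos.2 (sq_sub_sq_pos hs))
    (fun s hs => mul_le_mul_of_nonneg_left (hgb s hs).2 (by positivity)) (by simp)
    (by
      rw [integral_sqrt_eq_pi_mul hτ0.le, hτ, one_mul, inv_mul_lt_iff₀ hη0]
      change lpSlice p 1 < _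
      linarith)
  have hder : ∀ r ∈ Ioo (-1 : ℝ) 1,
      deriv X r = η⁻¹ * g r / √(τ ^ 2 - X r ^ 2) := fun r hr => (hXs r hr).2.1.deriv
  have hcoord : ∀ z ∈ lagrangianPSum n p (lt_of_lt_of_le two_pos hp),
      |z.1 0| ^ p + |z.2 0| ^ p < 1 := by
    intro z hz
    have hz' : ‖z.1‖ ^ p + ‖z.2‖ ^ p < 1 := hz
    have h1 : |z.1 0| ≤ ‖z.1‖ := PiLp.norm_apply_le z.1 0
    have h2 : |z.2 0| ≤ ‖z.2‖ := PiLp.norm_apply_le z.2 0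
    have h3 := Real.rpow_le_rpow (abs_nonneg _) h1 (by linarith : 0 ≤ p)
    have h4 := Real.rpow_le_rpow (abs_nonneg _) h2 (by linarith : 0 ≤ p)
    linarith
  have hpos : ∀ r ∈ Ioo (-1 : ℝ) 1, 0 < deriv X r := by
    intro r hr
    rw [hder r hr]
    exact div_pos (mul_pos (inv_pos.2 hη0) (hgpos r hr))
      (Real.sqrt_pos.2 (sq_sub_sq_pos (hXs r hr).1))
  refine symplecticallyEmbeds_of_first_coordinate hX hpos
    (fun z hz => mem_Ioo_of_rpow_add_rpow_lt_one hp (hcoord z hz)) ?_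
  intro z hz w hw1 hw2
  have hr := mem_Ioo_of_rpow_add_rpow_lt_one hp (hcoord z hz)
  have hy := (abs_lt_lpProfile_iff hp hr).2 (hcoord z hz)
  set r := z.1 0
  set y := z.2 0
  have hXr := (hXs r hr).1
  have hsq := sq_sub_sq_pos hXr
  have hb : lpProfile p r ≤ η⁻¹ * g r := by
    rw [le_inv_mul_iff₀ hη0]
    exact (hgb r hr).1
  have hlt : |w.2 0| < √(τ ^ 2 - X r ^ 2) := by
    rw [hw2, abs_mul, abs_inv, abs_of_pos (hpos r hr), inv_mul_lt_iff₀ (hpos r hr), hder r hr,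
      div_mul_cancel₀ _ (Real.sqrt_pos.2 hsq).ne']
    exact hy.trans_le hb
  have hlt2 : w.2 0 ^ 2 < τ ^ 2 - X r ^ 2 := by
    rw [← Real.sq_sqrt hsq.le, ← sq_abs (w.2 0)]
    exact pow_lt_pow_left₀ hlt (abs_nonneg _) two_ne_zero
  change Real.pi * (w.1 0 ^ 2 + w.2 0 ^ 2) < R
  rw [hw1, ← hτ]
  exact mul_lt_mul_of_pos_left (by linarith) hπ

/-- The radial transport bounds the radial eigenvalue of the fibre map by construction; the
rectangle comparison bounds the tangential one. -/
theorem ball_embeds_lagrangianPSum {n : ℕ} {p : ℝ} (hp : 2 ≤ p) {R : ℝ} (hR0 : 0 < R)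
    (hR : R < 4 * lpSlice p 1) :
    SymplecticallyEmbeds (ball n R) (lagrangianPSum n p (lt_of_lt_of_le two_pos hp)) := by
  have hK := lpSlice_one_pos hp
  have hπ := Real.pi_pos
  obtain ⟨τ, hτ0, hτ⟩ : ∃ τ, 0 < τ ∧ Real.pi * τ ^ 2 = R := by
    refine ⟨√(R / Real.pi), Real.sqrt_pos.2 (by positivity), ?_⟩
    rw [Real.sq_sqrt (by positivity)]
    field_simp
  obtain ⟨μ, hμ⟩ : ∃ μ, μ = R / (4 * lpSlice p 1) := ⟨_, rfl⟩
  have hμ0 : 0 < μ := by rw [hμ]; positivity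
  have hμ1 : μ < 1 := by rw [hμ]; exact (div_lt_one (by positivity)).2 hR
  have hμR : R = μ * (4 * lpSlice p 1) := by rw [hμ]; field_simp
  -- Both profiles are flattened, so the factor `η` is lost twice: `μ < η ^ 2` is what is needed.
  obtain ⟨η, hη1, hη2⟩ := exists_between (show √μ < 1 from (Real.sqrt_lt' one_pos).2 (by simpa using hμ1))
  have hη0 : 0 < η := lt_of_le_of_lt (Real.sqrt_nonneg μ) hη1
  have hμη : μ < η ^ 2 := (Real.sqrt_lt' hη0).1 hη1
  set a : ℝ → ℝ := fun s => √(τ ^ 2 - s ^ 2) with ha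
  have hac : Continuous a := by fun_prop
  have hapos : ∀ s ∈ Ioo (-τ) τ, 0 < a s := fun s hs => Real.sqrt_pos.2 (sq_sub_sq_pos hs)
  obtain ⟨g, hg, ⟨cg, hcg⟩, hgpos, hgb⟩ := exists_flattening one_pos hη0 hη2
    (continuous_lpProfile hp).continuousAt (fun s hs => lpProfile_pos hp hs)
    (fun s hs h0 => contDiffAt_lpProfile hp hs h0)
  obtain ⟨f, hf, ⟨cf, hcf⟩, hfpos, hfa⟩ := exists_flattening hτ0 hη0 hη2
    hac.continuousAt hapos
    (fun s hs _ => (contDiffOn_sqrt_sq_sub_sq τ).contDiffAt (isOpen_Ioo.mem_nhds hs))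
  obtain ⟨X, hX, hX0, hXs⟩ := exists_smooth_transport_of_le (α := fun s => η⁻¹ * f s)
    (a := a) (β := g) (b := lpProfile p) (C := η⁻¹) (η := η)
    hτ0 one_pos (by positivity) hac (continuous_lpProfile hp) (by simp [ha]) lpProfile_neg
    (fun s hs => (hapos s hs).le) (contDiffOn_const.mul hf)
    (fun s hs => mul_pos (inv_pos.2 hη0) (hfpos s hs)) hg hgpos
    (fun s hs => mul_le_mul_of_nonneg_left (hfa s hs).2 (by positivity))
    (fun s hs => (hgb s hs).1)
    (by
      rw [integral_sqrt_eq_pi_mul hτ0.le, hτ, inv_mul_lt_iff₀ hη0]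
      change _ < η * (η * lpSlice p 1)
      rw [hμR]
      nlinarith)
  have h0τ : (0 : ℝ) ∈ Ioo (-τ) τ := ⟨by linarith, hτ0⟩
  have hder : ∀ r ∈ Ioo (-τ) τ, deriv X r = η⁻¹ * f r / g (X r) :=
    fun r hr => (hXs r hr).2.1.deriv
  have hpos : ∀ r ∈ Ioo (-τ) τ, 0 < deriv X r := by
    intro r hr
    rw [hder r hr]
    exact div_pos (mul_pos (inv_pos.2 hη0) (hfpos r hr)) (hgpos _ (hXs r hr).1)
  have hlin : ∀ᶠ r in 𝓝 0, X r = η⁻¹ * cf / cg * r := by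
    have hXt : Tendsto X (𝓝 0) (𝓝 0) := by
      have := (hXs 0 h0τ).2.1.continuousAt.tendsto
      rwa [hX0] at this
    refine eventually_eq_mul_of_hasDerivAt hX0 ?_ ?_ (X' := fun r => η⁻¹ * f r / g (X r))
    · filter_upwards [isOpen_Ioo.mem_nhds h0τ] with r hr using (hXs r hr).2.1
    · filter_upwards [hcf, hXt.eventually hcg] with r h1 h2
      rw [h1, h2]
  have hk : 0 < η⁻¹ * cf / cg := by
    have h1 := hfpos 0 h0τ
    have h2 := hgpos 0 ⟨by norm_num, one_pos⟩
    rw [hcf.self_of_nhds] at h1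
    rw [hcg.self_of_nhds] at h2
    positivity
  obtain ⟨Φ, M, hΦ, hM, hinj, hdual, hΦM⟩ :=
    exists_radial_map (E := EuclideanSpace ℝ (Fin n)) hτ0 hk hX hpos hlin
  have hball : ∀ z ∈ ball n R, ‖z.1‖ ^ 2 + ‖z.2‖ ^ 2 < τ ^ 2 := by
    intro z hz
    have hz' : Real.pi * (‖z.1‖ ^ 2 + ‖z.2‖ ^ 2) < R := hz
    rw [← hτ] at hz'
    exact lt_of_mul_lt_mul_left hz' hπ.le
  have hW : ∀ z ∈ ball n R, z.1 ∈ Metric.ball (0 : EuclideanSpace ℝ (Fin n)) τ := by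
    intro z hz
    rw [mem_ball_zero_iff]
    exact lt_of_pow_lt_pow_left₀ 2 hτ0.le (by nlinarith [hball z hz, sq_nonneg ‖z.2‖])
  refine symplecticallyEmbeds_of_cotangentLift Metric.isOpen_ball hΦ hM hinj hdual hW ?_
  intro z hz
  obtain ⟨hnorm, hbound⟩ := hΦM z.1 (hW z hz)
  set r := ‖z.1‖ with hr
  have hr0 : 0 ≤ r := norm_nonneg _
  have hrτ : r < τ := by simpa using hW z hz
  have hrI : r ∈ Ioo (-τ) τ := ⟨by linarith, hrτ⟩
  have har := hapos r hrI
  obtain ⟨hXI, -, hXint⟩ := hXs r hrI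
  have hX0' : 0 ≤ X r := by rw [← hnorm]; exact norm_nonneg _
  have hXI' : X r ∈ Icc (0 : ℝ) 1 := ⟨hX0', hXI.2.le⟩
  have hbX := lpProfile_pos hp hXI
  have hgX := hgpos _ hXI
  have hfr : a r ≤ η⁻¹ * f r := by
    rw [le_inv_mul_iff₀ hη0]
    exact (hfa r hrI).1
  -- Radial eigenvalue: `X'` is the quotient of an upper bound for `a` by a lower bound for
  -- `lpProfile p`.
  have hX1 : (deriv X r)⁻¹ ≤ lpProfile p (X r) / a r := by
    rw [hder r hrI, inv_div]
    exact div_le_div₀ hbX.le (hgb _ hXI).2 har hfr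
  have hsub : ∀ s ∈ Icc 0 r, s ∈ Ioo (-τ) τ := fun s hs =>
    ⟨by linarith [hs.1], by linarith [hs.2]⟩
  have hsub' : ∀ s ∈ Icc 0 (X r), s ∈ Ioo (-1 : ℝ) 1 := fun s hs =>
    ⟨by linarith [hs.1], by linarith [hs.2, hXI.2]⟩
  have hfi : IntervalIntegrable f MeasureTheory.volume 0 r :=
    intervalIntegrable_of_continuousOn_Ioo hf.continuousOn h0τ hrI
  have hgi : IntervalIntegrable g MeasureTheory.volume 0 (X r) :=
    intervalIntegrable_of_continuousOn_Ioo hg.continuousOn ⟨by norm_num, one_pos⟩ hXI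
  have hbi : IntervalIntegrable (lpProfile p) MeasureTheory.volume 0 (X r) :=
    (continuous_lpProfile hp).intervalIntegrable _ _
  have hai : IntervalIntegrable a MeasureTheory.volume 0 r := hac.intervalIntegrable _ _
  have hlow : ∫ s in (0 : ℝ)..r, a s ≤ lpSlice p (X r) := by
    calc ∫ s in (0 : ℝ)..r, a s ≤ ∫ s in (0 : ℝ)..r, η⁻¹ * f s :=
          intervalIntegral.integral_mono_on hr0 hai (hfi.const_mul _) fun s hs => by
            rw [le_inv_mul_iff₀ hη0]
            exact (hfa s (hsub s hs)).1
      _ = ∫ s in (0 : ℝ)..X r, g s := hXint.symm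
      _ ≤ lpSlice p (X r) := intervalIntegral.integral_mono_on hX0' hgi hbi fun s hs =>
            (hgb s (hsub' s hs)).2
  -- The two flattening losses give `η ^ 2 * lpSlice p (X r)` as a lower bound, and `μ < η ^ 2`.
  have hup : μ * lpSlice p (X r) ≤ ∫ s in (0 : ℝ)..r, a s := by
    have h1 : η * lpSlice p (X r) ≤ ∫ s in (0 : ℝ)..X r, g s := by
      rw [lpSlice, ← intervalIntegral.integral_const_mul]
      exact intervalIntegral.integral_mono_on hX0' (hbi.const_mul _) hgi fun s hs =>
        (hgb s (hsub' s hs)).1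
    have h2 : ∫ s in (0 : ℝ)..r, η⁻¹ * f s ≤ η⁻¹ * ∫ s in (0 : ℝ)..r, a s := by
      rw [intervalIntegral.integral_const_mul]
      refine mul_le_mul_of_nonneg_left ?_ (by positivity)
      exact intervalIntegral.integral_mono_on hr0 hfi hai fun s hs => (hfa s (hsub s hs)).2
    rw [hXint] at h1
    have h3 := h1.trans h2
    rw [le_inv_mul_iff₀ hη0] at h3
    have h4 : 0 ≤ lpSlice p (X r) := intervalIntegral.integral_nonneg hX0' fun s hs =>
      (lpProfile_pos hp (hsub' s hs)).le
    nlinarith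
  -- Tangential eigenvalue: this is the rectangle comparison divided by `a r`.
  have hX2 : r ≤ lpProfile p (X r) / a r * X r := by
    have h := mul_le_mul_lpProfile hp hXI' hτ0 hμ0 (hτ.trans hμR) hr0 hrτ.le hlow hup
    rw [div_mul_eq_mul_div, le_div_iff₀ har]
    linarith
  have hMy := hbound _ hX1 hX2 z.2
  have hya : ‖z.2‖ < a r := by
    refine Real.lt_sqrt_of_sq_lt ?_
    linarith [hball z hz]
  have hMlt : ‖M z.1 z.2‖ < lpProfile p (X r) := by
    refine hMy.trans_lt ?_
    rw [div_mul_eq_mul_div, div_lt_iff₀ har]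
    exact mul_lt_mul_of_pos_left hya hbX
  change ‖Φ z.1‖ ^ p + ‖M z.1 z.2‖ ^ p < 1
  have h1 := Real.rpow_lt_rpow (norm_nonneg _) hMlt (by linarith : 0 < p)
  rw [lpProfile_rpow hp hXI'] at h1
  rw [hnorm]
  linarith

end Embeddings

/-! ### From embeddings to capacities -/

section Capacities

lemma rescale_ball (n : ℕ) {R : ℝ} (hR : 0 < R) :
    rescale (√R) (Real.sqrt_pos.2 hR) (ball n 1) = ball n R := by
  have h0 := Real.sqrt_pos.2 hR
  ext z
  change z ∈ √R • {z : PhaseSpace n | Real.pi * (‖z.1‖ ^ 2 + ‖z.2‖ ^ 2) < 1} ↔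
    Real.pi * (‖z.1‖ ^ 2 + ‖z.2‖ ^ 2) < R
  rw [mem_smul_set_iff_inv_smul_mem₀ h0.ne']
  simp only [mem_ofPred_eq, Prod.smul_fst, Prod.smul_snd, norm_smul, norm_inv, Real.norm_eq_abs,
    abs_of_pos h0, mul_pow, inv_pow, Real.sq_sqrt hR.le]
  rw [← mul_add, mul_left_comm, inv_mul_lt_iff₀ hR, mul_one]

lemma rescale_cylinder (n : ℕ) [NeZero n] {R : ℝ} (hR : 0 < R) :
    rescale (√R) (Real.sqrt_pos.2 hR) (cylinder n 1) = cylinder n R := by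
  have h0 := Real.sqrt_pos.2 hR
  ext z
  change z ∈ √R • {z : PhaseSpace n | Real.pi * (z.1 0 ^ 2 + z.2 0 ^ 2) < 1} ↔
    Real.pi * (z.1 0 ^ 2 + z.2 0 ^ 2) < R
  rw [mem_smul_set_iff_inv_smul_mem₀ h0.ne']
  simp only [mem_ofPred_eq, Prod.smul_fst, Prod.smul_snd, PiLp.smul_apply, smul_eq_mul, mul_pow,
    inv_pow, Real.sq_sqrt hR.le]
  rw [← mul_add, mul_left_comm, inv_mul_lt_iff₀ hR, mul_one]

variable {n : ℕ} [NeZero n] {c : TopologicalSpace.Opens (PhaseSpace n) → ℝ≥0∞}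

lemma IsNormalizedCapacity.gromovWidth_le (hc : IsNormalizedCapacity c)
    (U : TopologicalSpace.Opens (PhaseSpace n)) : gromovWidth U ≤ c U := by
  refine sSup_le ?_
  rintro _ ⟨R, hR, hemb, rfl⟩
  have h := hc.monotone _ _ hemb
  rwa [← rescale_ball n hR, hc.rescaling, hc.ball_eq_one, mul_one, Real.sq_sqrt hR.le] at h

lemma IsNormalizedCapacity.le_cylindricalCapacity (hc : IsNormalizedCapacity c)
    (U : TopologicalSpace.Opens (PhaseSpace n)) : c U ≤ cylindricalCapacity U := by
  refine le_sInf ?_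
  rintro _ ⟨R, hR, hemb, rfl⟩
  have h := hc.monotone _ _ hemb
  rwa [← rescale_cylinder n hR, hc.rescaling, hc.cylinder_eq_one, mul_one,
    Real.sq_sqrt hR.le] at h

theorem le_gromovWidth_lagrangianPSum (n : ℕ) {p : ℝ} (hp : 2 ≤ p) :
    ENNReal.ofReal (4 * lpSlice p 1) ≤
      gromovWidth (lagrangianPSum n p (lt_of_lt_of_le two_pos hp)) := by
  refine le_of_forall_lt_imp_le_of_dense fun e he => ?_
  have htop : e ≠ ⊤ := he.ne_top
  -- The Gromov width ranges over positive `R` only, so the value zero is treated apart.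
  rcases eq_or_ne e 0 with rfl | h0
  · exact zero_le
  have hpos := ENNReal.toReal_pos h0 htop
  refine le_sSup ⟨e.toReal, hpos, ball_embeds_lagrangianPSum hp hpos ?_,
    (ENNReal.ofReal_toReal htop).symm⟩
  exact (ENNReal.lt_ofReal_iff_toReal_lt htop).1 he

theorem cylindricalCapacity_lagrangianPSum_le (n : ℕ) [NeZero n] {p : ℝ} (hp : 2 ≤ p) :
    cylindricalCapacity (lagrangianPSum n p (lt_of_lt_of_le two_pos hp)) ≤
      ENNReal.ofReal (4 * lpSlice p 1) := by
  refine le_of_forall_gt_imp_ge_of_dense fun e he => ?_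
  rcases eq_or_ne e ⊤ with rfl | htop
  · exact le_top
  have hlt : 4 * lpSlice p 1 < e.toReal :=
    (ENNReal.ofReal_lt_iff_lt_toReal (by linarith [lpSlice_one_pos hp]) htop).1 he
  exact sInf_le ⟨e.toReal, by linarith [lpSlice_one_pos hp],
    lagrangianPSum_embeds_cylinder hp hlt, (ENNReal.ofReal_toReal htop).symm⟩

end Capacities

end SymplecticCapacity

theorem mainTheorem4 (p : ℝ) (hp : 2 ≤ p) :
    (∀ c : TopologicalSpace.Opens (SymplecticCapacity.PhaseSpace 2) → ENNReal,
      SymplecticCapacity.IsNormalizedCapacity c →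
        c (SymplecticCapacity.lagrangianPSum 2 p (lt_of_lt_of_le two_pos hp)) =
          ENNReal.ofReal (4 * Real.Gamma (1 + 1 / p) ^ 2 / Real.Gamma (1 + 2 / p))) ∧
    ENNReal.ofReal (4 * Real.Gamma (1 + 1 / p) ^ 2 / Real.Gamma (1 + 2 / p)) ≤
      SymplecticCapacity.gromovWidth
        (SymplecticCapacity.lagrangianPSum 2 p (lt_of_lt_of_le two_pos hp)) ∧
    SymplecticCapacity.cylindricalCapacity
        (SymplecticCapacity.lagrangianPSum 2 p (lt_of_lt_of_le two_pos hp)) ≤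
      ENNReal.ofReal (4 * Real.Gamma (1 + 1 / p) ^ 2 / Real.Gamma (1 + 2 / p)) := by
  rw [← SymplecticCapacity.four_mul_lpSlice_one hp]
  have hlow := SymplecticCapacity.le_gromovWidth_lagrangianPSum 2 hp
  have hup := SymplecticCapacity.cylindricalCapacity_lagrangianPSum_le 2 hp
  exact ⟨fun c hc => le_antisymm ((hc.le_cylindricalCapacity _).trans hup)
    (hlow.trans (hc.gromovWidth_le _)), hlow, hup⟩
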